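/- Let $k\ge 2$, $n\ge 1$ and $d_1,\dots,d_k\ge 1$ be integers, and let $\boldsymbol\delta=(\delta_1,\dots,\delta_k)\in(0,1]^k$. For tensors $X,Y\in\mathbb R^{d_1\times\cdots\times d_k}$ let $\langle Y,X\rangle$ be the entrywise inner product. For $1\le j_1<j_2\le k$ let $\mathscr U_{j_1j_2}(\boldsymbol\delta)$ be the set of rank-one tensors $u_1\otimes\cdots\otimes u_k$ with $u_j\in\mathbb R^{d_j}$, $\|u_j\|_{\ell_2}\le 1$ for all $j$, and $\|u_j\|_{\ell_\infty}\le\delta_j$ for all $j\ne j_1,j_2$. The incoherent spectral norm is $$\|X\|_{\circ,\boldsymbol\delta}=\sup\Big\{\langle Y,X\rangle:\ Y\in\bigcup_{1\le j_1<j_2\le k}\mathscr U_{j_1j_2}(\boldsymbol\delta)\Big\}.$$ Let $A\in\mathbb R^{d_1\times\cdots\times d_k}$ be a fixed non-zero tensor, $\|A\|_{\max}=\max_\omega|A(\omega)|$, let $\omega_1,\dots,\omega_n$ be i.i.d. uniform on $[d_1]\times\cdots\times[d_k]$, let $X_i=(d_1\cdots d_k)\,\mathcal P_{\omega_i}A$,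 where $\mathcal P_\omega A$ keeps the entry of $A$ at $\omega$ and sets all other entries to zero, and let $\bar X=\frac1n(X_1+\cdots+X_n)$. Write $$d=\frac1k\sum_{j=1}^k d_j,\quad d_*=(d_1\cdots d_k)^{1/k},\quad \delta_*=(\delta_1\cdots\delta_k)^{1/k},\quad \delta_{**}=\min_{1\le j_1<j_2\le k}\sqrt{\delta_{j_1}\delta_{j_2}}.$$ Suppose that $$\frac{8e}{9\log 2}\,k^2(\log d)^3\le d.$$ Then for every $\alpha>0$ and every $$t\ \ge\ 160(3\alpha+7)\frac kn\sqrt{d\log d_*}\,(2\delta_*d_*)^k\,\|A\|_{\max}\,\max_{1\le j_1<j_2\le k}\left\{\frac{n}{\delta_{j_1}^2d_{j_1}\delta_{j_2}^2d_{j_2}}+\frac{\log d}{\delta_{j_1}^2\delta_{j_2}^2}\right\}^{1/2}$$ one has $$\mathbb P\left\{\|\bar X-A\|_{\circ,\boldsymbol\delta}\ge t\right\}\le\frac12k^2d^{-\alpha}+\frac{1}{4(\log 2)^2}k^2(\log d)^2\left\{\exp\left(-\frac{9nt^2}{64k\,d_*^k\|A\|_{\max}^2\log d_*}\right)+\exp\left(-\frac{9nt}{32k\,\delta_*^k\delta_{**}^{-2}d_*^k\|A\|_{\max}\log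 d_*}\right)\right\}.$$ (If all $d_j=1$, then $\log d=0$ and the second summand on the right-hand side is read as $0$.) -/

import Mathlib

open MeasureTheory ProbabilityTheory

noncomputable section

/-- Multi-indices `(a₁, …, a_k) ∈ [d₁] × ⋯ × [d_k]`. -/
abbrev TensorIdx {k : ℕ} (d : Fin k → ℕ) : Type := ∀ j : Fin k, Fin (d j)

/-- Real tensors of order `k` and dimensions `d₁ × ⋯ × d_k`. -/
abbrev Tensor {k : ℕ} (d : Fin k → ℕ) : Type := TensorIdx d → ℝ

/-- Pairs `j₁ < j₂` of modes. -/
abbrev ModePair (k : ℕ) : Type := {p : Fin k × Fin k // p.1 < p.2}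

namespace Tensor

variable {k : ℕ} {d : Fin k → ℕ}

/-- The entrywise inner product `⟨Y, X⟩`. -/
def dot (Y X : Tensor d) : ℝ := ∑ a, Y a * X a

/-- The rank-one tensor `u₁ ⊗ ⋯ ⊗ u_k`. -/
def rankOne (u : ∀ j : Fin k, EuclideanSpace ℝ (Fin (d j))) : Tensor d :=
  fun a => ∏ j, u j (a j)

/-- Rank-one tensors `u₁ ⊗ ⋯ ⊗ u_k` with `‖u_j‖_{ℓ₂} ≤ 1` for all `j`, and `‖u_j‖_{ℓ_∞} ≤ δ_j` for
all `j` other than `j₁`, `j₂`. -/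
def incoherentPair (δ : Fin k → ℝ) (j₁ j₂ : Fin k) : Set (Tensor d) :=
  {Y | ∃ u : ∀ j : Fin k, EuclideanSpace ℝ (Fin (d j)),
    Y = rankOne u ∧ (∀ j, ‖u j‖ ≤ 1) ∧ ∀ j, j ≠ j₁ → j ≠ j₂ → ∀ i, |u j i| ≤ δ j}

/-- Rank-one tensors that are incoherent in all but two directions. -/
def incoherentSet (δ : Fin k → ℝ) : Set (Tensor d) :=
  ⋃ p : ModePair k, incoherentPair δ p.1.1 p.1.2

/-- The incoherent spectral norm `‖X‖_{∘,δ}`. -/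
def incoherentNorm (δ : Fin k → ℝ) (X : Tensor d) : ℝ :=
  sSup ((fun Y => dot Y X) '' incoherentSet δ)

/-- The largest absolute value `‖X‖_max` of an entry. -/
def maxNorm (X : Tensor d) : ℝ := ⨆ a, |X a|

/-- The projection `P_S` that keeps the entries in `S` and sets the others to zero. -/
def proj (S : Set (TensorIdx d)) (X : Tensor d) : Tensor d := S.indicator X

/-- The rescaled single-entry sample `(d₁ ⋯ d_k) P_w A`. -/
def sample (A : Tensor d) (w : TensorIdx d) : Tensor d :=
  (∏ j, (d j : ℝ)) • proj {w} A

/-- The average of the samples of `A` at the positions `w₁, …, w_n`. -/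
def sampleMean {n : ℕ} (A : Tensor d) (w : Fin n → TensorIdx d) : Tensor d :=
  (1 / (n : ℝ)) • ∑ i, sample A (w i)

end Tensor

/-- Arithmetic mean of a `k`-tuple. -/
def arithMean {k : ℕ} (x : Fin k → ℝ) : ℝ := (1 / (k : ℝ)) * ∑ j, x j

/-- Geometric mean of a `k`-tuple (of nonnegative numbers). -/
def geomMean {k : ℕ} (x : Fin k → ℝ) : ℝ := (∏ j, x j) ^ (1 / (k : ℝ))

/-- `min_{j₁ < j₂} √(δ_{j₁} δ_{j₂})`. -/
def minPairGeom {k : ℕ} (δ : Fin k → ℝ) : ℝ :=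
  ⨅ p : ModePair k, Real.sqrt (δ p.1.1 * δ p.1.2)

end

/-!
It suffices to bound, for each pair of modes `j₁ < j₂`, the probability that the supremum over the
tensors that are incoherent off `j₁, j₂` exceeds `t / 2` by `d ^ (-α)`; there are at most `k² / 2`
pairs, so this gives the first term of the bound, and the exponential terms are nonnegative.

Fix the pair. The form `Y ↦ ⟨Y, X̄ - A⟩` is multilinear in the vectors `u_j`, so each `u_j` may be
replaced by a vertex of a polytope that contains it (`exists_rankOne_le`). For `j ≠ j₁, j₂`
this is the cube of radius `δ_j`; for `j₁` and `j₂` it is the convex hull of the grid of mesh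
`1 / √d_j` in the ball of radius `2`. These are at most `exp (4 ∑ d_j)` tuples. For such a
tuple, with `x = |u_{j₁}|` and `y = |u_{j₂}|`, the summands are at most a constant times `x_a y_b`,
where `(a, b)` is the position of the sample in the modes `j₁, j₂`.

The argument then follows Kahn and Szemerédi. The light part, `x_a y_b ≤ τ`, is controlled by a
Bernstein inequality (`measureReal_sum_uniform_ge_le`) and a union bound over all tuples. The heavy
part is controlled deterministically (`sum_heavy_le`) by a discrepancy property of the sample, valid
simultaneously for all sets `A`, `B` of rows and columns (`measureReal_count_ge_le`): the number of
samples in `A × B` is at most `L |A| |B| + Λ (|A| + |B|)`. Where one of `x_a`, `y_b` is much larger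
than the other, the property is used for single rows and columns; in the balanced region it is used
for dyadic level sets. The choice `exists_parameters_bound` of the two cut-offs balances the terms,
and the factor `2 ^ k` in the hypothesis on `t` absorbs the remaining dependence on `k`.
-/

/-! ### Uniform samples -/

theorem integral_of_hasLaw_uniformOn {β Ω : Type*} [Fintype β] [Nonempty β] [MeasurableSpace β]
    [MeasurableSingletonClass β] [MeasurableSpace Ω] {μ : Measure Ω} {X : Ω → β}
    (hX : HasLaw X (uniformOn (Set.univ : Set β)) μ) (f : β → ℝ) :
    ∫ x, f (X x) ∂μ = (∑ b, f b) / Fintype.card β := by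
  have h1 : ∫ x, f (X x) ∂μ = ∫ b, f b ∂(uniformOn (Set.univ : Set β)) := by
    rw [← hX.map_eq, integral_map hX.aemeasurable]
    exact (measurable_of_finite f).aestronglyMeasurable
  rw [h1, integral_fintype Integrable.of_finite]
  rw [Finset.sum_div]
  refine Finset.sum_congr rfl fun b _ => ?_
  have : (uniformOn (Set.univ : Set β)).real {b} = 1 / Fintype.card β := by
    rw [Measure.real, uniformOn_univ, Measure.count_singleton]
    simp
  rw [this, smul_eq_mul]; ring

theorem exp_le_one_add_add_sq {x : ℝ} (hx : |x| ≤ 1) : Real.exp x ≤ 1 + x + x ^ 2 := by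
  have := Real.abs_exp_sub_one_sub_id_le hx
  linarith [(abs_le.1 this).2]

/-- A Bernstein bound for a sum of i.i.d. uniform samples of `f`, `|f| ≤ τ`: Markov's inequality
for the exponential moment at `1 / τ`, with the second moment of `f` in place of its variance. -/
theorem measureReal_sum_uniform_ge_le {n : ℕ} {β Ω : Type*} [Fintype β] [Nonempty β]
    [MeasurableSpace β] [MeasurableSingletonClass β] [MeasurableSpace Ω] {μ : Measure Ω}
    [IsProbabilityMeasure μ] {ω : Fin n → Ω → β} (hindep : iIndepFun ω μ)
    (hunif : ∀ i, HasLaw (ω i) (uniformOn (Set.univ : Set β)) μ)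
    {f : β → ℝ} {τ : ℝ} (hτ : 0 < τ) (hf : ∀ b, |f b| ≤ τ) (s : ℝ) :
    μ.real {x | n * ((∑ b, f b) / Fintype.card β) + n * ((∑ b, f b ^ 2) / Fintype.card β) / τ
      + τ * s ≤ ∑ i, f (ω i x)} ≤ Real.exp (-s) := by
  set N : ℝ := (Fintype.card β : ℝ) with hN
  have hNpos : 0 < N := by rw [hN]; exact_mod_cast Fintype.card_pos
  set m₁ := (∑ b, f b) / N
  set m₂ := (∑ b, f b ^ 2) / N
  have hfm : Measurable f := measurable_of_finite f
  have hmeas : ∀ i, AEMeasurable (fun x => f (ω i x)) μ := fun i =>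
    hfm.comp_aemeasurable (hunif i).aemeasurable
  have hind : iIndepFun (fun i x => f (ω i x)) μ := hindep.comp (fun _ => f) (fun _ => hfm)
  have hmgf : ∀ i, mgf (fun x => f (ω i x)) μ τ⁻¹ ≤ Real.exp (m₁ / τ + m₂ / τ ^ 2) := by
    intro i
    have h0 : mgf (fun x => f (ω i x)) μ τ⁻¹ = (∑ b, Real.exp (τ⁻¹ * f b)) / N :=
      integral_of_hasLaw_uniformOn (hunif i) (fun b => Real.exp (τ⁻¹ * f b))
    rw [h0]
    calc (∑ b, Real.exp (τ⁻¹ * f b)) / N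
        ≤ (∑ b, (1 + τ⁻¹ * f b + (τ⁻¹ * f b) ^ 2)) / N := by
          gcongr with b
          apply exp_le_one_add_add_sq
          rw [abs_mul, abs_of_pos (inv_pos.2 hτ), inv_mul_le_iff₀ hτ, mul_one]
          exact hf b
      _ = (m₁ / τ + m₂ / τ ^ 2) + 1 := by
          simp only [mul_pow, Finset.sum_add_distrib, ← Finset.mul_sum, m₁, m₂]
          simp only [Finset.sum_const, Finset.card_univ, nsmul_eq_mul, mul_one, ← hN]
          field_simp
          ring
      _ ≤ _ := Real.add_one_le_exp _
  have hmgf_sum : mgf (∑ i, fun x => f (ω i x)) μ τ⁻¹ ≤ Real.exp (n * (m₁ / τ + m₂ / τ ^ 2)) := by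
    rw [hind.mgf_sum₀ hmeas]
    calc _ ≤ ∏ i : Fin n, Real.exp (m₁ / τ + m₂ / τ ^ 2) :=
          Finset.prod_le_prod (fun i _ => mgf_nonneg) (fun i _ => hmgf i)
      _ = _ := by rw [Finset.prod_const, Finset.card_univ, Fintype.card_fin, ← Real.exp_nat_mul]
  have hint : Integrable (fun x => Real.exp (τ⁻¹ * (∑ i, fun x => f (ω i x)) x)) μ := by
    refine Integrable.of_bound (C := Real.exp (τ⁻¹ * (n * τ))) ?_ ?_
    · refine AEMeasurable.aestronglyMeasurable ?_
      refine Real.measurable_exp.comp_aemeasurable ?_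
      refine AEMeasurable.const_mul ?_ _
      exact Finset.aemeasurable_sum _ (fun i _ => hmeas i)
    · refine Filter.Eventually.of_forall fun x => ?_
      rw [Real.norm_eq_abs, Real.abs_exp]
      refine Real.exp_le_exp.2 ?_
      refine mul_le_mul_of_nonneg_left ?_ (inv_pos.2 hτ).le
      rw [Finset.sum_apply]
      calc ∑ i, f (ω i x) ≤ ∑ i : Fin n, τ := Finset.sum_le_sum fun i _ => (abs_le.1 (hf _)).2
        _ = _ := by simp
  have h := measure_ge_le_exp_mul_mgf (μ := μ) (X := ∑ i, fun x => f (ω i x))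
    (n * m₁ + n * m₂ / τ + τ * s) (inv_pos.2 hτ).le hint
  simp only [Finset.sum_apply] at h
  refine h.trans ?_
  calc _ ≤ Real.exp (-τ⁻¹ * (n * m₁ + n * m₂ / τ + τ * s))
            * Real.exp (n * (m₁ / τ + m₂ / τ ^ 2)) := by gcongr
    _ = Real.exp (-s) := by
        rw [← Real.exp_add]; congr 1; field_simp; ring

/-- The uniform average of a function of two different coordinates factorizes. -/
theorem sum_mul_two_coord_div_card {k : ℕ} {d : Fin k → ℕ} (hd : ∀ j, 1 ≤ d j) {j₁ j₂ : Fin k}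
    (h12 : j₁ ≠ j₂)
    (F : Fin (d j₁) → ℝ) (G : Fin (d j₂) → ℝ) :
    (∑ w : TensorIdx d, F (w j₁) * G (w j₂)) / Fintype.card (TensorIdx d)
      = (∑ a, F a) * (∑ b, G b) / (d j₁ * d j₂) := by
  classical
  have hpos : ∀ j, (d j : ℝ) ≠ 0 := fun j => by have := hd j; positivity
  -- Every mode gets a factor, equal to `1` off `j₁` and `j₂`, so that the sum of products splits.
  let Φ : ∀ j, Fin (d j) → ℝ := fun j a =>
    (if h : j₁ = j then F (h ▸ a) else 1) * (if h : j₂ = j then G (h ▸ a) else 1)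
  have h1 : ∀ w : TensorIdx d, F (w j₁) * G (w j₂) = ∏ j, Φ j (w j) := by
    intro w
    simp only [Φ, Finset.prod_mul_distrib]
    rw [Finset.prod_eq_single j₁, Finset.prod_eq_single j₂]
    · simp
    · intro j _ hj; rw [dif_neg (Ne.symm hj)]
    · simp
    · intro j _ hj; rw [dif_neg (Ne.symm hj)]
    · simp
  have h2 : ∑ w : TensorIdx d, ∏ j, Φ j (w j) = ∏ j, ∑ a, Φ j a := by
    rw [Finset.prod_univ_sum, Fintype.piFinset_univ]
  have h3 : (Fintype.card (TensorIdx d) : ℝ) = ∏ j, (d j : ℝ) := by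
    simp [Fintype.card_pi]
  simp only [h1]
  rw [h2, h3, ← Finset.prod_div_distrib, Fintype.prod_eq_mul j₁ j₂ h12]
  · have e1 : ∀ a, Φ j₁ a = F a := by intro a; simp [Φ, h12.symm]
    have e2 : ∀ a, Φ j₂ a = G a := by intro a; simp [Φ, h12]
    simp only [e1, e2]
    rw [div_mul_div_comm]
  · rintro j ⟨hj1, hj2⟩
    simp [Φ, hj1.symm, hj2.symm, hpos j]

/-! ### Heavy positions -/

/-- A geometric series: distinct powers of two that are at most `X` add up to at most `2 X`. -/
theorem sum_two_zpow_le (S : Finset ℤ) : ∀ X : ℝ, 0 ≤ X → (∀ j ∈ S, (2 : ℝ) ^ j ≤ X) →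
    ∑ j ∈ S, (2 : ℝ) ^ j ≤ 2 * X := by
  induction S using Finset.induction_on_max with
  | empty => intro X hX _; simpa using hX
  | insert a s hlt ih =>
    intro X _ h
    have ha := h a (Finset.mem_insert_self _ _)
    rw [Finset.sum_insert (fun hmem => lt_irrefl _ (hlt a hmem))]
    have h1 := ih ((2 : ℝ) ^ (a - 1)) (by positivity) (fun j hj =>
      zpow_le_zpow_right₀ (by norm_num) (by have := hlt j hj; omega))
    rw [zpow_sub_one₀ (by norm_num)] at h1
    linarith

/-- If `y` is at least `K x` at all samples, the sum of `x y` over the samples is at most that of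
`y² / K`, which is controlled by the largest multiplicity `M` of a value of `b`. -/
theorem sum_dominated_le {ι β γ : Type*} [Fintype γ] [DecidableEq γ] (T : Finset ι)
    (a : ι → β) (b : ι → γ) {x : β → ℝ} {y : γ → ℝ} {K : ℝ} (hK : 0 < K)
    (hy : ∀ j, 0 ≤ y j) (hy2 : ∑ j, y j ^ 2 ≤ 4)
    {M : ℝ} (hM : 0 ≤ M) (hdeg : ∀ j, ((T.filter fun i => b i = j).card : ℝ) ≤ M)
    (hdom : ∀ i ∈ T, K * x (a i) ≤ y (b i)) :
    ∑ i ∈ T, x (a i) * y (b i) ≤ 4 * M / K := by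
  calc ∑ i ∈ T, x (a i) * y (b i) ≤ ∑ i ∈ T, y (b i) ^ 2 / K := by
        refine Finset.sum_le_sum fun i hi => ?_
        rw [le_div_iff₀ hK]
        nlinarith [hdom i hi, hy (b i)]
    _ = ∑ j, ∑ i ∈ T.filter (fun i => b i = j), y j ^ 2 / K := by
        rw [← Finset.sum_fiberwise T b]
        refine Finset.sum_congr rfl fun j _ => Finset.sum_congr rfl fun i hi => ?_
        rw [(Finset.mem_filter.1 hi).2]
    _ ≤ ∑ j, M * (y j ^ 2 / K) := by
        refine Finset.sum_le_sum fun j _ => ?_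
        rw [Finset.sum_const, nsmul_eq_mul]
        exact mul_le_mul_of_nonneg_right (hdeg j) (by positivity)
    _ = M * (∑ j, y j ^ 2) / K := by
        rw [← Finset.mul_sum, ← Finset.sum_div]; ring
    _ ≤ M * 4 / K := by gcongr
    _ = _ := by ring

/-- The positions at which `2 ^ s ≤ x < 2 ^ (s + 1)`. The condition `0 < x` is needed because
`Int.log 2 0 = 0`. -/
noncomputable def dyadicLevel {β : Type*} [Fintype β] (x : β → ℝ) (s : ℤ) : Finset β :=
  Finset.univ.filter fun a => 0 < x a ∧ Int.log 2 (x a) = s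

theorem mem_dyadicLevel {β : Type*} [Fintype β] {x : β → ℝ} {s : ℤ} {a : β} :
    a ∈ dyadicLevel x s ↔ 0 < x a ∧ Int.log 2 (x a) = s := by
  simp [dyadicLevel]

theorem two_zpow_log_le {x : ℝ} (hx : 0 < x) : (2 : ℝ) ^ Int.log 2 x ≤ x := by
  simpa using Int.zpow_log_le_self (b := 2) (by norm_num) hx

theorem lt_two_mul_zpow_log (x : ℝ) : x < 2 * (2 : ℝ) ^ Int.log 2 x := by
  have := Int.lt_zpow_succ_log_self (b := 2) (by norm_num) x
  rw [zpow_add_one₀ (by norm_num)] at this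
  push_cast at this
  linarith

theorem sum_card_dyadicLevel_le {β : Type*} [Fintype β] {x : β → ℝ} (hx2 : ∑ j, x j ^ 2 ≤ 4)
    (S : Finset ℤ) :
    ∑ s ∈ S, ((2 : ℝ) ^ s) ^ 2 * (dyadicLevel x s).card ≤ 4 := by
  classical
  calc ∑ s ∈ S, ((2 : ℝ) ^ s) ^ 2 * (dyadicLevel x s).card
      = ∑ s ∈ S, ∑ a, if 0 < x a ∧ Int.log 2 (x a) = s then ((2 : ℝ) ^ s) ^ 2 else 0 := by
        refine Finset.sum_congr rfl fun s _ => ?_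
        rw [← Finset.sum_filter, Finset.sum_const, nsmul_eq_mul, mul_comm]; rfl
    _ = ∑ a, ∑ s ∈ S, if 0 < x a ∧ Int.log 2 (x a) = s then ((2 : ℝ) ^ s) ^ 2 else 0 :=
        Finset.sum_comm
    _ ≤ ∑ a, x a ^ 2 := by
        refine Finset.sum_le_sum fun a _ => ?_
        by_cases ha : 0 < x a
        · simp only [ha, true_and]
          rw [Finset.sum_ite_eq]
          split_ifs
          · have := two_zpow_log_le ha
            gcongr
          · positivity
        · simp only [ha, false_and, if_false, Finset.sum_const_zero]
          positivity
    _ ≤ 4 := hx2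

/-- Comparable pairs of levels: for each `s` the levels `2 ^ r ≤ 2 K 2 ^ s` form a geometric
series dominated by its largest term. -/
theorem sum_level_pairs_le {β : Type*} [Fintype β] {x : β → ℝ} (hx2 : ∑ j, x j ^ 2 ≤ 4)
    (P : Finset (ℤ × ℤ)) {K : ℝ} (hK : 0 < K) (hP : ∀ z ∈ P, (2 : ℝ) ^ z.2 ≤ 2 * K * 2 ^ z.1) :
    ∑ z ∈ P, (2 : ℝ) ^ z.1 * 2 ^ z.2 * (dyadicLevel x z.1).card ≤ 16 * K := by
  classical
  calc ∑ z ∈ P, (2 : ℝ) ^ z.1 * 2 ^ z.2 * (dyadicLevel x z.1).card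
      ≤ ∑ s ∈ P.image Prod.fst, ∑ z ∈ P.filter (fun z => z.1 = s),
          (2 : ℝ) ^ s * (dyadicLevel x s).card * 2 ^ z.2 := by
        rw [← Finset.sum_fiberwise_of_maps_to (t := P.image Prod.fst) (g := Prod.fst)
          (fun z hz => Finset.mem_image_of_mem _ hz)]
        refine Finset.sum_le_sum fun s _ => Finset.sum_le_sum fun z hz => ?_
        rw [(Finset.mem_filter.1 hz).2]
        exact le_of_eq (by ring)
    _ ≤ ∑ s ∈ P.image Prod.fst, (2 : ℝ) ^ s * (dyadicLevel x s).card * (2 * (2 * K * 2 ^ s)) := by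
        refine Finset.sum_le_sum fun s _ => ?_
        rw [← Finset.mul_sum]
        refine mul_le_mul_of_nonneg_left ?_ (by positivity)
        have hinj : Set.InjOn Prod.snd
            ((P.filter fun z => z.1 = s : Finset (ℤ × ℤ)) : Set (ℤ × ℤ)) := by
          intro z hz z' hz' h
          have h1 := (Finset.mem_filter.1 hz).2
          have h2 := (Finset.mem_filter.1 hz').2
          exact Prod.ext (h1.trans h2.symm) h
        rw [← Finset.sum_image (f := fun j : ℤ => (2 : ℝ) ^ j) hinj]
        refine sum_two_zpow_le _ _ (by positivity) fun j hj => ?_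
        obtain ⟨z, hz, rfl⟩ := Finset.mem_image.1 hj
        have h1 := Finset.mem_filter.1 hz
        rw [← h1.2]
        exact hP z h1.1
    _ = 4 * K * ∑ s ∈ P.image Prod.fst, ((2 : ℝ) ^ s) ^ 2 * (dyadicLevel x s).card := by
        rw [Finset.mul_sum]
        exact Finset.sum_congr rfl fun s _ => by ring
    _ ≤ 4 * K * 4 := by
        gcongr
        exact sum_card_dyadicLevel_le hx2 _
    _ = _ := by ring

/-- Heavy pairs of levels: if `τ ≤ 4 · 2 ^ s · 2 ^ r`, one factor `2 ^ (s + r)` can be traded for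
its square, and the sum then factorizes. -/
theorem sum_heavy_level_pairs_mul_le {β γ : Type*} [Fintype β] [Fintype γ] {x : β → ℝ} {y : γ → ℝ}
    (hx2 : ∑ j, x j ^ 2 ≤ 4) (hy2 : ∑ j, y j ^ 2 ≤ 4) (P : Finset (ℤ × ℤ)) {τ : ℝ} (hτ : 0 < τ)
    (hP : ∀ z ∈ P, τ ≤ 4 * ((2 : ℝ) ^ z.1 * 2 ^ z.2)) :
    ∑ z ∈ P, ((2 : ℝ) ^ z.1 * 2 ^ z.2) * (((dyadicLevel x z.1).card : ℝ) * (dyadicLevel y z.2).card)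
      ≤ 64 / τ := by
  classical
  let F : ℤ → ℝ := fun s => ((2 : ℝ) ^ s) ^ 2 * (dyadicLevel x s).card
  let G : ℤ → ℝ := fun s => ((2 : ℝ) ^ s) ^ 2 * (dyadicLevel y s).card
  have hF : ∀ s, 0 ≤ F s := fun s => by positivity
  have hG : ∀ s, 0 ≤ G s := fun s => by positivity
  have hterm : ∀ z ∈ P, ((2 : ℝ) ^ z.1 * 2 ^ z.2) *
      (((dyadicLevel x z.1).card : ℝ) * (dyadicLevel y z.2).card) ≤ (4 / τ) * (F z.1 * G z.2) := by
    intro z hz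
    have h1 : (1 : ℝ) ≤ 4 / τ * ((2 : ℝ) ^ z.1 * 2 ^ z.2) := by
      rw [div_mul_eq_mul_div, le_div_iff₀ hτ, one_mul]; exact hP z hz
    refine (le_mul_of_one_le_left (by positivity) h1).trans (le_of_eq ?_)
    simp only [F, G]; ring
  calc _ ≤ ∑ z ∈ P, (4 / τ) * (F z.1 * G z.2) := Finset.sum_le_sum hterm
    _ ≤ ∑ z ∈ P.image Prod.fst ×ˢ P.image Prod.snd, (4 / τ) * (F z.1 * G z.2) :=
        Finset.sum_le_sum_of_subset_of_nonneg Finset.subset_product fun z _ _ =>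
          mul_nonneg (by positivity) (mul_nonneg (hF _) (hG _))
    _ = (4 / τ) * ((∑ s ∈ P.image Prod.fst, F s) * ∑ s ∈ P.image Prod.snd, G s) := by
        rw [← Finset.mul_sum, Finset.sum_mul_sum, Finset.sum_product]
    _ ≤ (4 / τ) * (4 * 4) :=
        mul_le_mul_of_nonneg_left (mul_le_mul (sum_card_dyadicLevel_le hx2 _)
          (sum_card_dyadicLevel_le hy2 _) (Finset.sum_nonneg fun s _ => hG s) (by norm_num))
          (by positivity)
    _ = 64 / τ := by ring

/-- Heavy samples with `x` and `y` within a factor `K` of each other. The samples are grouped by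
the dyadic levels of `x` and `y`, and the discrepancy property `hcnt` is applied to each pair of
level sets. -/
theorem sum_balanced_le {ι β γ : Type*} [Fintype β] [Fintype γ] [DecidableEq β] [DecidableEq γ]
    (T : Finset ι) (a : ι → β) (b : ι → γ) {x : β → ℝ} {y : γ → ℝ} {K L Λ τ : ℝ} (hK : 0 < K)
    (hL : 0 ≤ L) (hΛ : 0 ≤ Λ) (hτ : 0 < τ)
    (hx : ∀ j, 0 ≤ x j) (hy : ∀ j, 0 ≤ y j)
    (hx2 : ∑ j, x j ^ 2 ≤ 4) (hy2 : ∑ j, y j ^ 2 ≤ 4)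
    (hcnt : ∀ (A : Finset β) (B : Finset γ),
      ((T.filter fun i => a i ∈ A ∧ b i ∈ B).card : ℝ)
        ≤ L * (A.card * B.card) + Λ * (A.card + B.card))
    (hheavy : ∀ i ∈ T, τ < x (a i) * y (b i))
    (hxy : ∀ i ∈ T, x (a i) ≤ K * y (b i)) (hyx : ∀ i ∈ T, y (b i) ≤ K * x (a i)) :
    ∑ i ∈ T, x (a i) * y (b i) ≤ 256 * L / τ + 128 * Λ * K := by
  classical
  have hpos : ∀ i ∈ T, 0 < x (a i) ∧ 0 < y (b i) := by
    intro i hi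
    have h1 : 0 < x (a i) * y (b i) := hτ.trans (hheavy i hi)
    have h2 := hx (a i)
    have h3 := hy (b i)
    constructor
    · exact lt_of_le_of_ne h2 fun h => by simp [← h] at h1
    · exact lt_of_le_of_ne h3 fun h => by simp [← h] at h1
  let φ : ι → ℤ × ℤ := fun i => (Int.log 2 (x (a i)), Int.log 2 (y (b i)))
  let P := T.image φ
  have hP1 : ∀ z ∈ P, (2 : ℝ) ^ z.2 ≤ 2 * K * 2 ^ z.1 := by
    intro z hz
    obtain ⟨i, hi, rfl⟩ := Finset.mem_image.1 hz
    have h1 := two_zpow_log_le (hpos i hi).2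
    have h2 := lt_two_mul_zpow_log (x (a i))
    have h3 := hyx i hi
    simp only [φ]
    nlinarith
  have hP2 : ∀ z ∈ P, (2 : ℝ) ^ z.1 ≤ 2 * K * 2 ^ z.2 := by
    intro z hz
    obtain ⟨i, hi, rfl⟩ := Finset.mem_image.1 hz
    have h1 := two_zpow_log_le (hpos i hi).1
    have h2 := lt_two_mul_zpow_log (y (b i))
    have h3 := hxy i hi
    simp only [φ]
    nlinarith
  have hP3 : ∀ z ∈ P, τ ≤ 4 * ((2 : ℝ) ^ z.1 * 2 ^ z.2) := by
    intro z hz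
    obtain ⟨i, hi, rfl⟩ := Finset.mem_image.1 hz
    have h1 := lt_two_mul_zpow_log (x (a i))
    have h2 := lt_two_mul_zpow_log (y (b i))
    have h3 := hheavy i hi
    have h4 : x (a i) * y (b i) ≤ (2 * (2 : ℝ) ^ Int.log 2 (x (a i)))
        * (2 * (2 : ℝ) ^ Int.log 2 (y (b i))) :=
      mul_le_mul h1.le h2.le (hy _) (by positivity)
    simp only [φ]
    linarith
  set X : ℤ → ℝ := fun s => ((dyadicLevel x s).card : ℝ) with hX
  set Y : ℤ → ℝ := fun s => ((dyadicLevel y s).card : ℝ) with hY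
  have hX0 : ∀ s, 0 ≤ X s := fun s => Nat.cast_nonneg _
  have hY0 : ∀ s, 0 ≤ Y s := fun s => Nat.cast_nonneg _
  have hstep : ∑ i ∈ T, x (a i) * y (b i) ≤ ∑ z ∈ P, 4 * ((2 : ℝ) ^ z.1 * 2 ^ z.2)
      * (L * (X z.1 * Y z.2) + Λ * (X z.1 + Y z.2)) := by
    rw [← Finset.sum_fiberwise_of_maps_to (t := P) (g := φ)
          (fun z hz => Finset.mem_image_of_mem _ hz)]
    refine Finset.sum_le_sum fun z _ => ?_
    calc ∑ i ∈ T with φ i = z, x (a i) * y (b i)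
        ≤ ∑ i ∈ T with φ i = z, 4 * ((2 : ℝ) ^ z.1 * 2 ^ z.2) := by
          refine Finset.sum_le_sum fun i hi => ?_
          rw [← (Finset.mem_filter.1 hi).2]
          have h1 := lt_two_mul_zpow_log (x (a i))
          have h2 := lt_two_mul_zpow_log (y (b i))
          have h4 : x (a i) * y (b i) ≤ (2 * (2 : ℝ) ^ Int.log 2 (x (a i)))
              * (2 * (2 : ℝ) ^ Int.log 2 (y (b i))) :=
            mul_le_mul h1.le h2.le (hy _) (by positivity)
          simp only [φ]
          linarith
      _ = 4 * ((2 : ℝ) ^ z.1 * 2 ^ z.2) * ((T.filter fun i => φ i = z).card : ℝ) := by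
          rw [Finset.sum_const, nsmul_eq_mul, mul_comm]
      _ ≤ 4 * ((2 : ℝ) ^ z.1 * 2 ^ z.2) * ((T.filter fun i => a i ∈ dyadicLevel x z.1 ∧
            b i ∈ dyadicLevel y z.2).card : ℝ) := by
          refine mul_le_mul_of_nonneg_left ?_ (by positivity)
          refine Nat.cast_le.2 (Finset.card_le_card fun i hi => ?_)
          rw [Finset.mem_filter] at hi ⊢
          refine ⟨hi.1, ?_⟩
          rw [mem_dyadicLevel, mem_dyadicLevel, ← hi.2]
          exact ⟨⟨(hpos i hi.1).1, rfl⟩, ⟨(hpos i hi.1).2, rfl⟩⟩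
      _ ≤ _ := mul_le_mul_of_nonneg_left (hcnt _ _) (by positivity)
  have hS1 : ∑ z ∈ P, ((2 : ℝ) ^ z.1 * 2 ^ z.2) * (X z.1 * Y z.2) ≤ 64 / τ :=
    sum_heavy_level_pairs_mul_le hx2 hy2 P hτ hP3
  have hS2 : ∑ z ∈ P, (2 : ℝ) ^ z.1 * 2 ^ z.2 * X z.1 ≤ 16 * K := sum_level_pairs_le hx2 P hK hP1
  have hS3 : ∑ z ∈ P, (2 : ℝ) ^ z.1 * 2 ^ z.2 * Y z.2 ≤ 16 * K := by
    have h := sum_level_pairs_le hy2 (P.map (Equiv.prodComm ℤ ℤ).toEmbedding) hK (by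
      intro z hz
      obtain ⟨w, hw, rfl⟩ := Finset.mem_map.1 hz
      exact hP2 w hw)
    rw [Finset.sum_map] at h
    refine le_trans (le_of_eq ?_) h
    refine Finset.sum_congr rfl fun z _ => ?_
    simp only [Equiv.coe_toEmbedding, Equiv.prodComm_apply, Prod.fst_swap, Prod.snd_swap, hY]
    ring
  calc _ ≤ _ := hstep
    _ = 4 * L * (∑ z ∈ P, ((2 : ℝ) ^ z.1 * 2 ^ z.2) * (X z.1 * Y z.2))
        + 4 * Λ * ((∑ z ∈ P, (2 : ℝ) ^ z.1 * 2 ^ z.2 * X z.1)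
          + ∑ z ∈ P, (2 : ℝ) ^ z.1 * 2 ^ z.2 * Y z.2) := by
        rw [← Finset.sum_add_distrib, Finset.mul_sum, Finset.mul_sum, ← Finset.sum_add_distrib]
        exact Finset.sum_congr rfl fun z _ => by ring
    _ ≤ 4 * L * (64 / τ) + 4 * Λ * (16 * K + 16 * K) := by gcongr
    _ = _ := by ring

/-- The sum of `x y` over heavy samples (`τ < x y`), under the discrepancy property `hcnt`. Samples
with `x` and `y` within a factor `K` are handled by `sum_balanced_le`, the others by
`sum_dominated_le`, where `hcnt` for a single row or column bounds the multiplicity. -/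
theorem sum_heavy_le {ι β γ : Type*} [Fintype β] [Fintype γ] [DecidableEq β] [DecidableEq γ]
    (T : Finset ι) (a : ι → β) (b : ι → γ) {x : β → ℝ} {y : γ → ℝ} {K L Λ τ : ℝ} (hK : 0 < K)
    (hL : 0 ≤ L) (hΛ : 0 ≤ Λ) (hτ : 0 < τ)
    (hx : ∀ j, 0 ≤ x j) (hy : ∀ j, 0 ≤ y j)
    (hx2 : ∑ j, x j ^ 2 ≤ 4) (hy2 : ∑ j, y j ^ 2 ≤ 4)
    (hcnt : ∀ (A : Finset β) (B : Finset γ),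
      ((T.filter fun i => a i ∈ A ∧ b i ∈ B).card : ℝ)
        ≤ L * (A.card * B.card) + Λ * (A.card + B.card))
    (hheavy : ∀ i ∈ T, τ < x (a i) * y (b i)) :
    ∑ i ∈ T, x (a i) * y (b i) ≤ 256 * L / τ + 128 * Λ * K
      + 4 * (L * Fintype.card γ + Λ * (1 + Fintype.card γ)) / K
      + 4 * (L * Fintype.card β + Λ * (1 + Fintype.card β)) / K := by
  classical
  have hsub : ∀ (T' : Finset ι), T' ⊆ T → ∀ (A : Finset β) (B : Finset γ),
      ((T'.filter fun i => a i ∈ A ∧ b i ∈ B).card : ℝ)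
        ≤ L * (A.card * B.card) + Λ * (A.card + B.card) := fun T' hT' A B =>
    le_trans (by exact_mod_cast Finset.card_le_card (Finset.filter_subset_filter _ hT')) (hcnt A B)
  let p₁ : ι → Prop := fun i => x (a i) ≤ K * y (b i)
  let p₂ : ι → Prop := fun i => y (b i) ≤ K * x (a i)
  rw [← Finset.sum_filter_add_sum_filter_not T p₁, ← Finset.sum_filter_add_sum_filter_not
    (T.filter p₁) p₂]
  have h1 := sum_balanced_le ((T.filter p₁).filter p₂) a b hK hL hΛ hτ hx hy hx2 hy2
    (hsub _ ((Finset.filter_subset _ _).trans (Finset.filter_subset _ _)))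
    (fun i hi => hheavy i (Finset.mem_filter.1 (Finset.mem_filter.1 hi).1).1)
    (fun i hi => (Finset.mem_filter.1 (Finset.mem_filter.1 hi).1).2)
    (fun i hi => (Finset.mem_filter.1 hi).2)
  have h2 : ∑ i ∈ (T.filter p₁).filter (fun i => ¬ p₂ i), x (a i) * y (b i)
      ≤ 4 * (L * Fintype.card β + Λ * (1 + Fintype.card β)) / K := by
    refine sum_dominated_le _ a b hK hy hy2 (by positivity) (fun j => ?_) (fun i hi => ?_)
    · have := hsub _ ((Finset.filter_subset (fun i => ¬ p₂ i) _).trans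
        (Finset.filter_subset p₁ T)) Finset.univ {j}
      simp only [Finset.mem_univ, true_and, Finset.mem_singleton, Finset.card_singleton,
        Finset.card_univ, Nat.cast_one, mul_one] at this
      linarith
    · exact (not_le.1 (Finset.mem_filter.1 hi).2).le
  have h3 : ∑ i ∈ T.filter (fun i => ¬ p₁ i), x (a i) * y (b i)
      ≤ 4 * (L * Fintype.card γ + Λ * (1 + Fintype.card γ)) / K := by
    have := sum_dominated_le (T.filter (fun i => ¬ p₁ i)) b a (x := y) (y := x) hK hx hx2
      (M := L * Fintype.card γ + Λ * (1 + Fintype.card γ)) (by positivity) (fun j => ?_)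
      (fun i hi => (not_le.1 (Finset.mem_filter.1 hi).2).le)
    · simpa only [mul_comm] using this
    · have := hsub _ (Finset.filter_subset (fun i => ¬ p₁ i) T) {j} Finset.univ
      simp only [Finset.mem_univ, and_true, Finset.mem_singleton, Finset.card_singleton,
        Finset.card_univ, Nat.cast_one, one_mul] at this
      linarith
  linarith

/-! ### Polytopes with few vertices -/

theorem mem_convexHull_of_corners {m : ℕ} {u l r : Fin m → ℝ} {S : Set (Fin m → ℝ)}
    (hl : ∀ i, l i ≤ u i) (hr : ∀ i, u i ≤ r i)
    (hS : ∀ v : Fin m → ℝ, (∀ i, v i = l i ∨ v i = r i) → v ∈ S) : u ∈ convexHull ℝ S := by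
  have h : u ∈ convexHull ℝ (Set.univ.pi fun i => ({l i, r i} : Set ℝ)) := by
    rw [convexHull_pi]
    intro i _
    change u i ∈ convexHull ℝ {l i, r i}
    rw [convexHull_pair, segment_eq_Icc ((hl i).trans (hr i))]
    exact ⟨hl i, hr i⟩
  refine convexHull_mono (fun v hv => hS v fun i => ?_) h
  simpa using hv i (Set.mem_univ i)

/-- The vertices of the cube `[-δ, δ] ^ m`. -/
noncomputable def signNet (m : ℕ) (δ : ℝ) : Finset (Fin m → ℝ) := Fintype.piFinset fun _ => {-δ, δ}

theorem mem_convexHull_signNet {m : ℕ} {δ : ℝ} {u : Fin m → ℝ} (hu : ∀ i, |u i| ≤ δ) :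
    u ∈ convexHull ℝ (signNet m δ : Set (Fin m → ℝ)) := by
  refine mem_convexHull_of_corners (l := fun _ => -δ) (r := fun _ => δ)
    (fun i => (abs_le.1 (hu i)).1) (fun i => (abs_le.1 (hu i)).2) fun v hv => ?_
  simpa [signNet] using hv

theorem abs_le_of_mem_signNet {m : ℕ} {δ : ℝ} (hδ : 0 ≤ δ) {v : Fin m → ℝ} (hv : v ∈ signNet m δ)
    (i : Fin m) : |v i| ≤ δ := by
  have h : v i = -δ ∨ v i = δ := by simpa using Fintype.mem_piFinset.1 hv i
  rcases h with h | h <;> simp [h, abs_of_nonneg hδ]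

theorem card_signNet_le (m : ℕ) (δ : ℝ) : ((signNet m δ).card : ℝ) ≤ Real.exp (4 * m) := by
  have h1 : (signNet m δ).card ≤ 2 ^ m := by
    rw [signNet, Fintype.card_piFinset]
    refine (Finset.prod_le_pow_card _ _ 2 fun i _ => Finset.card_le_two).trans (by simp)
  calc ((signNet m δ).card : ℝ) ≤ (2 : ℝ) ^ m := by exact_mod_cast h1
    _ ≤ (Real.exp 4) ^ m := by
        gcongr
        linarith [Real.add_one_le_exp (4 : ℝ)]
    _ = _ := by rw [← Real.exp_nat_mul]; ring_nf

/-- The integer points of the Euclidean ball of radius `2 √m`. The bounds `± 2 m` on the coordinates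
are implied by the inequality and only serve to make this a `Finset`; see `mem_latticeBall`. -/
noncomputable def latticeBall (m : ℕ) : Finset (Fin m → ℤ) :=
  (Fintype.piFinset fun _ : Fin m => Finset.Icc (-(2 * m : ℤ)) (2 * m)).filter
    fun z => ∑ i, z i ^ 2 ≤ 4 * m

theorem mem_latticeBall {m : ℕ} {z : Fin m → ℤ} : z ∈ latticeBall m ↔ ∑ i, z i ^ 2 ≤ 4 * m := by
  rw [latticeBall, Finset.mem_filter, and_iff_right_iff_imp, Fintype.mem_piFinset]
  intro h i
  have h1 : z i ^ 2 ≤ 4 * m :=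
    (Finset.single_le_sum (f := fun i => z i ^ 2) (fun j _ => sq_nonneg _) (Finset.mem_univ i)).trans h
  have hm : (1 : ℤ) ≤ m := by have := i.pos; omega
  rw [Finset.mem_Icc]
  constructor <;> nlinarith

theorem sum_half_pow_natAbs_le (M : ℕ) :
    ∑ z ∈ Finset.Icc (-(M : ℤ)) M, (1 / 2 : ℝ) ^ z.natAbs ≤ 3 - 2 * (1 / 2) ^ M := by
  induction M with
  | zero => norm_num
  | succ M ih =>
    have h : Finset.Icc (-((M + 1 : ℕ) : ℤ)) ((M + 1 : ℕ) : ℤ)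
        = insert (-((M + 1 : ℕ) : ℤ)) (insert (((M + 1 : ℕ) : ℤ)) (Finset.Icc (-(M : ℤ)) M)) := by
      ext z
      simp only [Finset.mem_Icc, Finset.mem_insert]
      omega
    rw [h, Finset.sum_insert, Finset.sum_insert]
    · rw [Int.natAbs_neg, Int.natAbs_natCast, pow_succ]
      linarith
    · simp
    · simp only [Finset.mem_insert, Finset.mem_Icc]
      omega

/-- Each point of the ball has weight at least `1` under the product weight
`∏ i, 16 · 2 ^ (-|z i|)`, whose total mass is at most `48 ^ m`. -/
theorem card_latticeBall_le (m : ℕ) : ((latticeBall m).card : ℝ) ≤ Real.exp (4 * m) := by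
  have h48 : (48 : ℝ) ≤ Real.exp 4 := by
    have h := Real.exp_one_gt_d9
    have : Real.exp 4 = Real.exp 1 ^ 4 := by rw [← Real.exp_nat_mul]; norm_num
    rw [this]
    calc (48 : ℝ) ≤ 2.7 ^ 4 := by norm_num
      _ ≤ _ := by gcongr; linarith
  calc ((latticeBall m).card : ℝ) = ∑ z ∈ latticeBall m, (1 : ℝ) := by simp
    _ ≤ ∑ z ∈ latticeBall m, ∏ i : Fin m, (16 * (1 / 2 : ℝ) ^ (z i).natAbs) := by
        refine Finset.sum_le_sum fun z hz => ?_
        rw [mem_latticeBall] at hz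
        have hexp : ∑ i, (z i).natAbs ≤ 4 * m := by
          have h : ((∑ i, (z i).natAbs : ℕ) : ℤ) ≤ 4 * m := by
            push_cast
            refine (Finset.sum_le_sum fun i _ => ?_).trans hz
            rw [← Int.natCast_natAbs]
            exact Int.natAbs_le_self_sq (z i)
          exact_mod_cast h
        rw [Finset.prod_mul_distrib, Finset.prod_pow_eq_pow_sum, Finset.prod_const,
          Finset.card_univ, Fintype.card_fin]
        calc (1 : ℝ) = 16 ^ m * (1 / 2 : ℝ) ^ (4 * m) := by
              rw [pow_mul, ← mul_pow]; norm_num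
          _ ≤ _ := by
              gcongr 16 ^ m * ?_
              exact pow_le_pow_of_le_one (by norm_num) (by norm_num) hexp
    _ ≤ ∑ z ∈ Fintype.piFinset fun _ : Fin m => Finset.Icc (-(2 * m : ℤ)) (2 * m),
          ∏ i : Fin m, (16 * (1 / 2 : ℝ) ^ (z i).natAbs) :=
        Finset.sum_le_sum_of_subset_of_nonneg (Finset.filter_subset _ _) fun z _ _ => by positivity
    _ = ∏ _i : Fin m, ∑ z ∈ Finset.Icc (-(2 * m : ℤ)) (2 * m), (16 * (1 / 2 : ℝ) ^ z.natAbs) :=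
        (Finset.prod_univ_sum (fun _ : Fin m => Finset.Icc (-(2 * m : ℤ)) (2 * m))
          fun _ z => 16 * (1 / 2 : ℝ) ^ z.natAbs).symm
    _ ≤ ∏ _i : Fin m, Real.exp 4 := by
        refine Finset.prod_le_prod (fun i _ => Finset.sum_nonneg fun z _ => by positivity)
          fun i _ => ?_
        have h := sum_half_pow_natAbs_le (2 * m)
        push_cast at h
        rw [← Finset.mul_sum]
        have : (0 : ℝ) ≤ 2 * (1 / 2) ^ (2 * m) := by positivity
        linarith
    _ = _ := by
        rw [Finset.prod_const, Finset.card_univ, Fintype.card_fin, ← Real.exp_nat_mul]; ring_nf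

/-- The points of the grid of mesh `1 / √m` in the Euclidean ball of radius `2`. -/
noncomputable def gridNet (m : ℕ) : Finset (Fin m → ℝ) :=
  (latticeBall m).image fun z i => (z i : ℝ) / √m

theorem card_gridNet_le (m : ℕ) : ((gridNet m).card : ℝ) ≤ Real.exp (4 * m) :=
  le_trans (by exact_mod_cast Finset.card_image_le) (card_latticeBall_le m)

theorem sum_sq_le_of_mem_gridNet {m : ℕ} {v : Fin m → ℝ} (hv : v ∈ gridNet m) :
    ∑ i, v i ^ 2 ≤ 4 := by
  obtain ⟨z, hz, rfl⟩ := Finset.mem_image.1 hv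
  rw [mem_latticeBall] at hz
  simp only [div_pow, Real.sq_sqrt (Nat.cast_nonneg m : (0 : ℝ) ≤ m)]
  rw [← Finset.sum_div]
  refine div_le_of_le_mul₀ (Nat.cast_nonneg m) (by norm_num) ?_
  exact_mod_cast hz

/-- The corners of the grid cell of a point `u` of the unit ball are within `1` of `u` in `ℓ₂`,
hence in the ball of radius `2`. -/
theorem mem_convexHull_gridNet {m : ℕ} {u : Fin m → ℝ} (hu : ∑ i, u i ^ 2 ≤ 1) :
    u ∈ convexHull ℝ (gridNet m : Set (Fin m → ℝ)) := by
  rcases Nat.eq_zero_or_pos m with rfl | hm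
  · refine subset_convexHull ℝ _ ?_
    refine Finset.mem_coe.2 (Finset.mem_image.2 ⟨fun _ => 0, ?_, Subsingleton.elim _ _⟩)
    simp [mem_latticeBall]
  have hs : 0 < √(m : ℝ) := Real.sqrt_pos.2 (by exact_mod_cast hm)
  refine mem_convexHull_of_corners (l := fun i => (⌊u i * √m⌋ : ℝ) / √m)
    (r := fun i => ((⌊u i * √m⌋ + 1 : ℤ) : ℝ) / √m) (fun i => ?_) (fun i => ?_) fun v hv => ?_
  · rw [div_le_iff₀ hs]; exact Int.floor_le _
  · rw [le_div_iff₀ hs]; push_cast; exact (Int.lt_floor_add_one _).le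
  · have hz : ∀ i, ∃ z : ℤ, v i = z / √m ∧ |(z : ℝ) - u i * √m| ≤ 1 := by
      intro i
      have h1 := Int.floor_le (u i * √m)
      have h2 := Int.lt_floor_add_one (u i * √m)
      rcases hv i with h | h
      · exact ⟨_, h, abs_le.2 ⟨by linarith, by linarith⟩⟩
      · refine ⟨_, h, abs_le.2 ⟨?_, ?_⟩⟩ <;> push_cast <;> linarith
    choose z hz1 hz2 using hz
    refine Finset.mem_coe.2 (Finset.mem_image.2 ⟨z, ?_, funext fun i => (hz1 i).symm⟩)
    rw [mem_latticeBall]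
    have key : ∑ i, (z i : ℝ) ^ 2 ≤ 4 * m := by
      calc ∑ i, (z i : ℝ) ^ 2 ≤ ∑ i, (2 * m * u i ^ 2 + 2) := by
            refine Finset.sum_le_sum fun i _ => ?_
            have h1 : ((z i : ℝ) - u i * √m) ^ 2 ≤ 1 := by
              rw [← sq_abs]; nlinarith [hz2 i, abs_nonneg ((z i : ℝ) - u i * √m)]
            have h2 : (u i * √m) ^ 2 = m * u i ^ 2 := by
              rw [mul_pow, Real.sq_sqrt (Nat.cast_nonneg m)]; ring
            nlinarith [sq_nonneg ((z i : ℝ) - 2 * (u i * √m))]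
        _ = 2 * m * (∑ i, u i ^ 2) + 2 * m := by
            rw [Finset.sum_add_distrib, ← Finset.mul_sum]; simp; ring
        _ ≤ 2 * m * 1 + 2 * m := by gcongr
        _ = _ := by ring
    exact_mod_cast key

/-- A multilinear form on a product of convex hulls is maximal at a tuple of vertices: the vectors
are replaced by vertices one mode at a time. -/
theorem exists_rankOne_le {k : ℕ} {d : Fin k → ℕ} (X : Tensor d)
    (V : ∀ j, Finset (Fin (d j) → ℝ)) (u : ∀ j, Fin (d j) → ℝ)
    (hu : ∀ j, u j ∈ convexHull ℝ (V j : Set (Fin (d j) → ℝ))) :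
    ∃ v ∈ Fintype.piFinset V, ∑ a : TensorIdx d, (∏ j, u j (a j)) * X a
      ≤ ∑ a : TensorIdx d, (∏ j, v j (a j)) * X a := by
  classical
  let f : (∀ j, Fin (d j) → ℝ) → ℝ := fun v => ∑ a : TensorIdx d, (∏ j, v j (a j)) * X a
  have key : ∀ s : Finset (Fin k), ∃ v : ∀ j, Fin (d j) → ℝ,
      (∀ j ∈ s, v j ∈ V j) ∧ (∀ j ∉ s, v j = u j) ∧ f u ≤ f v := by
    intro s
    induction s using Finset.induction_on with
    | empty => exact ⟨u, by simp, by simp, le_rfl⟩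
    | insert i s hi ih =>
      obtain ⟨v, hv1, hv2, hv3⟩ := ih
      let g : (Fin (d i) → ℝ) →ₗ[ℝ] ℝ :=
        ∑ a : TensorIdx d, (((∏ j ∈ Finset.univ.erase i, v j (a j)) * X a) •
          (LinearMap.proj (a i) : (Fin (d i) → ℝ) →ₗ[ℝ] ℝ))
      have hg : ∀ y, g y = f (Function.update v i y) := by
        intro y
        simp only [g, f, LinearMap.sum_apply, LinearMap.smul_apply, LinearMap.proj_apply,
          smul_eq_mul]
        refine Finset.sum_congr rfl fun a _ => ?_
        rw [← Finset.mul_prod_erase _ _ (Finset.mem_univ i), Function.update_self]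
        have : ∏ j ∈ Finset.univ.erase i, Function.update v i y j (a j)
            = ∏ j ∈ Finset.univ.erase i, v j (a j) :=
          Finset.prod_congr rfl fun j hj => by
            rw [Function.update_of_ne (Finset.ne_of_mem_erase hj)]
        rw [this]; ring
      have hconv : ConvexOn ℝ Set.univ g := g.convexOn convex_univ
      obtain ⟨y, hy, hyle⟩ := hconv.exists_ge_of_mem_convexHull (Set.subset_univ _) (hu i)
      refine ⟨Function.update v i y, ?_, ?_, ?_⟩
      · intro j hj
        by_cases h : j = i
        · subst h; simpa using hy
        · rw [Function.update_of_ne h]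
          exact hv1 j ((Finset.mem_insert.1 hj).resolve_left h)
      · intro j hj
        rw [Finset.mem_insert, not_or] at hj
        rw [Function.update_of_ne hj.1]
        exact hv2 j hj.2
      · have h1 : f v = g (u i) := by
          rw [hg, ← hv2 i hi, Function.update_eq_self]
        rw [← hg]
        exact (hv3.trans_eq h1).trans hyle
  obtain ⟨v, hv1, _, hv3⟩ := key Finset.univ
  exact ⟨v, Fintype.mem_piFinset.2 fun j => hv1 j (Finset.mem_univ j), hv3⟩

/-! ### Light and heavy parts of the deviation -/

theorem sum_exp_neg_card_mul_log_le {m : ℕ} (hm : 1 ≤ m) :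
    ∑ A : Finset (Fin m), Real.exp (-(A.card * Real.log m)) ≤ Real.exp 1 := by
  have hm0 : (0 : ℝ) < m := by exact_mod_cast hm
  have h1 : ∀ A : Finset (Fin m), Real.exp (-(A.card * Real.log m))
      = (1 / m : ℝ) ^ A.card * 1 ^ (Fintype.card (Fin m) - A.card) := by
    intro A
    rw [one_pow, mul_one, ← mul_neg, Real.exp_nat_mul, Real.exp_neg, Real.exp_log hm0, one_div]
  simp only [h1]
  rw [Fintype.sum_pow_mul_eq_add_pow, Fintype.card_fin]
  calc (1 / m + 1 : ℝ) ^ m ≤ Real.exp (1 / m) ^ m := by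
        gcongr
        exact Real.add_one_le_exp _
    _ = Real.exp 1 := by
        rw [← Real.exp_nat_mul]; congr 1; field_simp

/-- The discrepancy property: outside an event of probability at most `exp (2 - s)`, all sets `A`,
`B` of rows and columns contain at most twice the expected number of samples plus an entropy term. The entropy
terms are weights for the union bound, which total `exp 2` by `sum_exp_neg_card_mul_log_le`. -/
theorem measureReal_count_ge_le {k n : ℕ} {d : Fin k → ℕ} (hd : ∀ j, 1 ≤ d j)
    {Ω : Type*} [MeasurableSpace Ω] {μ : Measure Ω} [IsProbabilityMeasure μ]
    {ω : Fin n → Ω → TensorIdx d} (hindep : iIndepFun ω μ)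
    (hunif : ∀ i, HasLaw (ω i) (uniformOn (Set.univ : Set (TensorIdx d))) μ)
    {j₁ j₂ : Fin k} (h12 : j₁ ≠ j₂) (s : ℝ) :
    μ.real {x | ∃ (A : Finset (Fin (d j₁))) (B : Finset (Fin (d j₂))),
      2 * (n / (d j₁ * d j₂)) * (A.card * B.card)
        + (A.card * Real.log (d j₁) + B.card * Real.log (d j₂) + s)
      ≤ ((Finset.univ.filter fun i => ω i x j₁ ∈ A ∧ ω i x j₂ ∈ B).card : ℝ)}
      ≤ Real.exp (2 - s) := by
  have : Nonempty (TensorIdx d) := ⟨fun j => ⟨0, hd j⟩⟩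
  set E : Finset (Fin (d j₁)) × Finset (Fin (d j₂)) → Set Ω := fun z => {x |
      2 * (n / (d j₁ * d j₂)) * ((z.1.card : ℝ) * z.2.card)
        + (z.1.card * Real.log (d j₁) + z.2.card * Real.log (d j₂) + s)
      ≤ ((Finset.univ.filter fun i => ω i x j₁ ∈ z.1 ∧ ω i x j₂ ∈ z.2).card : ℝ)} with hE
  have hEle : ∀ z, μ.real (E z) ≤ Real.exp (-(z.1.card * Real.log (d j₁)))
      * Real.exp (-(z.2.card * Real.log (d j₂))) * Real.exp (-s) := by
    intro z
    let F : Fin (d j₁) → ℝ := fun a => if a ∈ z.1 then 1 else 0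
    let G : Fin (d j₂) → ℝ := fun b => if b ∈ z.2 then 1 else 0
    let f : TensorIdx d → ℝ := fun w => F (w j₁) * G (w j₂)
    have hf : ∀ w, |f w| ≤ 1 := by
      intro w
      simp only [f, F, G]
      split_ifs <;> simp
    have hsq : ∀ w, f w ^ 2 = f w := by
      intro w
      simp only [f, F, G]
      split_ifs <;> simp
    have havg : (∑ w, f w) / Fintype.card (TensorIdx d)
        = (z.1.card : ℝ) * z.2.card / (d j₁ * d j₂) := by
      simp only [f]
      rw [sum_mul_two_coord_div_card hd h12 F G]
      simp [F, G]
    have h := measureReal_sum_uniform_ge_le hindep hunif one_pos hf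
      (z.1.card * Real.log (d j₁) + z.2.card * Real.log (d j₂) + s)
    simp only [hsq, havg] at h
    rw [← Real.exp_add, ← Real.exp_add]
    refine (le_of_eq ?_).trans (h.trans (le_of_eq ?_))
    · congr 1
      ext x
      have : ∑ i, f (ω i x)
          = ((Finset.univ.filter fun i => ω i x j₁ ∈ z.1 ∧ ω i x j₂ ∈ z.2).card : ℝ) := by
        rw [Finset.card_filter]
        push_cast
        refine Finset.sum_congr rfl fun i _ => ?_
        simp only [f, F, G]
        split_ifs <;> simp_all
      simp only [hE, Set.mem_ofPred_eq, this]
      rw [show (2 * (n / (d j₁ * d j₂)) * ((z.1.card : ℝ) * z.2.card) : ℝ)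
        = n * (z.1.card * z.2.card / (d j₁ * d j₂))
          + n * (z.1.card * z.2.card / (d j₁ * d j₂)) / 1 by ring, one_mul]
    · congr 1; ring
  calc _ ≤ μ.real (⋃ z, E z) := by
        refine measureReal_mono ?_
        rintro x ⟨A, B, h⟩
        exact Set.mem_iUnion.2 ⟨(A, B), h⟩
    _ ≤ ∑ z, μ.real (E z) := measureReal_iUnion_fintype_le _
    _ ≤ ∑ z : Finset (Fin (d j₁)) × Finset (Fin (d j₂)),
          Real.exp (-(z.1.card * Real.log (d j₁)))
            * Real.exp (-(z.2.card * Real.log (d j₂))) * Real.exp (-s) :=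
        Finset.sum_le_sum fun z _ => hEle z
    _ = (∑ A : Finset (Fin (d j₁)), Real.exp (-(A.card * Real.log (d j₁))))
          * (∑ B : Finset (Fin (d j₂)), Real.exp (-(B.card * Real.log (d j₂)))) * Real.exp (-s) := by
        rw [← Finset.sum_mul, Fintype.sum_prod_type, Finset.sum_mul_sum]
    _ ≤ Real.exp 1 * Real.exp 1 * Real.exp (-s) := by
        gcongr
        · exact sum_exp_neg_card_mul_log_le (hd j₁)
        · exact sum_exp_neg_card_mul_log_le (hd j₂)
    _ = _ := by rw [← Real.exp_add, ← Real.exp_add]; congr 1; ring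

/-- The restriction of `F` to the light positions, those with `X Y ≤ τ`. -/
noncomputable def lightPart {k : ℕ} {d : Fin k → ℕ} {j₁ j₂ : Fin k} (X : Fin (d j₁) → ℝ) (Y : Fin (d j₂) → ℝ)
    (τ : ℝ) (F : TensorIdx d → ℝ) : TensorIdx d → ℝ :=
  fun w => if X (w j₁) * Y (w j₂) ≤ τ then F w else 0

section deviation
variable {k : ℕ} {d : Fin k → ℕ} {j₁ j₂ : Fin k} {X : Fin (d j₁) → ℝ} {Y : Fin (d j₂) → ℝ}
  {τ : ℝ} {F : TensorIdx d → ℝ}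

theorem sum_sq_mul_sq_div_card_le (hd : ∀ j, 1 ≤ d j) (h12 : j₁ ≠ j₂)
    (hX2 : ∑ a, X a ^ 2 ≤ 4) (hY2 : ∑ b, Y b ^ 2 ≤ 4) :
    (∑ w : TensorIdx d, X (w j₁) ^ 2 * Y (w j₂) ^ 2) / Fintype.card (TensorIdx d)
      ≤ 16 / (d j₁ * d j₂) := by
  rw [sum_mul_two_coord_div_card hd h12 (fun a => X a ^ 2) (fun b => Y b ^ 2)]
  gcongr
  calc _ ≤ (4 : ℝ) * 4 := by gcongr
    _ = 16 := by norm_num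

/-- The deterministic step: a Bernstein bound for the light part and the discrepancy property bound
the deviation of the empirical sum of `F` from its mean, if `F` is dominated by the product of two
vectors of norm at most `2`. -/
theorem deviation_le {n : ℕ} (hd : ∀ j, 1 ≤ d j) (h12 : j₁ ≠ j₂) (hτ : 0 < τ)
    (hX : ∀ a, 0 ≤ X a) (hY : ∀ b, 0 ≤ Y b)
    (hX2 : ∑ a, X a ^ 2 ≤ 4) (hY2 : ∑ b, Y b ^ 2 ≤ 4)
    (hF : ∀ w, |F w| ≤ X (w j₁) * Y (w j₂)) {s Λ K : ℝ} (hΛ : 0 ≤ Λ) (hK : 0 < K)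
    (w : Fin n → TensorIdx d)
    (hlight : ∑ i, lightPart X Y τ F (w i)
      ≤ n * ((∑ b, lightPart X Y τ F b) / Fintype.card (TensorIdx d))
        + n * ((∑ b, lightPart X Y τ F b ^ 2) / Fintype.card (TensorIdx d)) / τ + τ * s)
    (hcnt : ∀ (A : Finset (Fin (d j₁))) (B : Finset (Fin (d j₂))),
      ((Finset.univ.filter fun i => w i j₁ ∈ A ∧ w i j₂ ∈ B).card : ℝ)
        ≤ 2 * (n / (d j₁ * d j₂)) * (A.card * B.card) + Λ * (A.card + B.card)) :
    ∑ i, F (w i) - n * ((∑ b, F b) / Fintype.card (TensorIdx d))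
      ≤ 544 * (n / (d j₁ * d j₂)) / τ + τ * s + 128 * Λ * K
        + 8 * (n / (d j₁ * d j₂) + Λ) * (d j₁ + d j₂) / K := by
  have : Nonempty (TensorIdx d) := ⟨fun j => ⟨0, hd j⟩⟩
  set N : ℝ := (Fintype.card (TensorIdx d) : ℝ) with hN
  have hN0 : 0 < N := by rw [hN]; exact_mod_cast Fintype.card_pos
  set r : ℝ := (n : ℝ) / (d j₁ * d j₂) with hr
  have hr0 : 0 ≤ r := by positivity
  have hp : (1 : ℝ) ≤ d j₁ := by exact_mod_cast hd j₁
  have hq : (1 : ℝ) ≤ d j₂ := by exact_mod_cast hd j₂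
  have hm2 := sum_sq_mul_sq_div_card_le hd h12 hX2 hY2
  rw [← hN] at hm2
  have hnr : (n : ℝ) * (16 / (d j₁ * d j₂)) = 16 * r := by rw [hr]; ring
  have hvar : n * ((∑ b, lightPart X Y τ F b ^ 2) / N) / τ ≤ 16 * r / τ := by
    rw [← hnr]
    gcongr n * ?_ / τ
    refine le_trans ?_ hm2
    gcongr with b
    rw [← mul_pow, ← sq_abs]
    gcongr
    refine le_trans ?_ (hF b)
    unfold lightPart
    split_ifs
    · exact le_rfl
    · simp
  -- On heavy positions `X Y ≤ (X Y)² / τ`, so the mean of the heavy part is controlled by `hm2`.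
  have hmean : n * ((∑ b, lightPart X Y τ F b) / N) - n * ((∑ b, F b) / N) ≤ 16 * r / τ := by
    rw [← mul_sub, ← sub_div, ← Finset.sum_sub_distrib, ← hnr, mul_div_assoc]
    gcongr n * ?_
    rw [le_div_iff₀ hτ]
    refine le_trans ?_ hm2
    rw [div_mul_eq_mul_div, Finset.sum_mul]
    refine div_le_div_of_nonneg_right (Finset.sum_le_sum fun b _ => ?_) hN0.le
    have hXY : 0 ≤ X (b j₁) * Y (b j₂) := mul_nonneg (hX _) (hY _)
    unfold lightPart
    split_ifs with h
    · rw [sub_self, zero_mul]; positivity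
    · have h1 := (abs_le.1 (hF b)).1
      rw [not_le] at h
      nlinarith
  have hheavy : ∑ i, F (w i) - ∑ i, lightPart X Y τ F (w i)
      ≤ ∑ i with τ < X (w i j₁) * Y (w i j₂), X (w i j₁) * Y (w i j₂) := by
    rw [← Finset.sum_sub_distrib, Finset.sum_filter]
    refine Finset.sum_le_sum fun i _ => ?_
    unfold lightPart
    by_cases h : X (w i j₁) * Y (w i j₂) ≤ τ
    · rw [if_pos h, if_neg (not_lt.2 h), sub_self]
    · rw [if_neg h, if_pos (not_le.1 h), sub_zero]
      exact (abs_le.1 (hF _)).2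
  have hH := sum_heavy_le (Finset.univ.filter fun i => τ < X (w i j₁) * Y (w i j₂))
    (fun i => w i j₁) (fun i => w i j₂) hK (L := 2 * r) (by positivity) hΛ hτ hX hY hX2 hY2
    (fun A B => le_trans (by
      exact_mod_cast Finset.card_le_card (Finset.filter_subset_filter _ (Finset.subset_univ _)))
      (hcnt A B))
    (fun i hi => (Finset.mem_filter.1 hi).2)
  rw [Fintype.card_fin, Fintype.card_fin] at hH
  have hdeg : 4 * (2 * r * d j₂ + Λ * (1 + d j₂)) / K + 4 * (2 * r * d j₁ + Λ * (1 + d j₁)) / K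
      ≤ 8 * (r + Λ) * (d j₁ + d j₂) / K := by
    rw [← add_div]
    gcongr
    nlinarith
  have e : 544 * r / τ = 16 * r / τ + 16 * r / τ + 256 * (2 * r) / τ := by ring
  linarith

end deviation

/-- The bound of `deviation_le` holds for a whole finite family `F`: only the light parts need a
union bound over the family, since the discrepancy property does not depend on `F`. -/
theorem measureReal_deviation_gt_le {k n : ℕ} {d : Fin k → ℕ} (hd : ∀ j, 1 ≤ d j)
    {Ω : Type*} [MeasurableSpace Ω] {μ : Measure Ω} [IsProbabilityMeasure μ]
    {ω : Fin n → Ω → TensorIdx d} (hindep : iIndepFun ω μ)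
    (hunif : ∀ i, HasLaw (ω i) (uniformOn (Set.univ : Set (TensorIdx d))) μ)
    {j₁ j₂ : Fin k} (h12 : j₁ ≠ j₂) {ι : Type*} (V : Finset ι)
    (X : ι → Fin (d j₁) → ℝ) (Y : ι → Fin (d j₂) → ℝ) (F : ι → TensorIdx d → ℝ)
    (hX : ∀ v ∈ V, ∀ a, 0 ≤ X v a) (hY : ∀ v ∈ V, ∀ b, 0 ≤ Y v b)
    (hX2 : ∀ v ∈ V, ∑ a, X v a ^ 2 ≤ 4) (hY2 : ∀ v ∈ V, ∑ b, Y v b ^ 2 ≤ 4)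
    (hF : ∀ v ∈ V, ∀ w, |F v w| ≤ X v (w j₁) * Y v (w j₂))
    {s s₀ Λ K τ : ℝ} (hτ : 0 < τ) (hK : 0 < K) (hs₀ : 0 ≤ s₀)
    (hΛ₁ : Real.log (d j₁) + s₀ ≤ Λ) (hΛ₂ : Real.log (d j₂) + s₀ ≤ Λ) :
    μ.real {x | ∃ v ∈ V, 544 * (n / (d j₁ * d j₂)) / τ + τ * s + 128 * Λ * K
        + 8 * (n / (d j₁ * d j₂) + Λ) * (d j₁ + d j₂) / K
        < ∑ i, F v (ω i x) - n * ((∑ b, F v b) / Fintype.card (TensorIdx d))}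
      ≤ V.card * Real.exp (-s) + Real.exp (2 - s₀) := by
  have : Nonempty (TensorIdx d) := ⟨fun j => ⟨0, hd j⟩⟩
  have hl1 : 0 ≤ Real.log (d j₁) := Real.log_natCast_nonneg _
  have hl2 : 0 ≤ Real.log (d j₂) := Real.log_natCast_nonneg _
  have hΛ : 0 ≤ Λ := by linarith
  let EL : ι → Set Ω := fun v => {x |
    n * ((∑ b, lightPart (X v) (Y v) τ (F v) b) / Fintype.card (TensorIdx d))
      + n * ((∑ b, lightPart (X v) (Y v) τ (F v) b ^ 2) / Fintype.card (TensorIdx d)) / τ + τ * s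
      ≤ ∑ i, lightPart (X v) (Y v) τ (F v) (ω i x)}
  let EC : Set Ω := {x | ∃ (A : Finset (Fin (d j₁))) (B : Finset (Fin (d j₂))),
      2 * (n / (d j₁ * d j₂)) * (A.card * B.card)
        + (A.card * Real.log (d j₁) + B.card * Real.log (d j₂) + s₀)
      ≤ ((Finset.univ.filter fun i => ω i x j₁ ∈ A ∧ ω i x j₂ ∈ B).card : ℝ)}
  have hsub : {x | ∃ v ∈ V, 544 * (n / (d j₁ * d j₂)) / τ + τ * s + 128 * Λ * K
        + 8 * (n / (d j₁ * d j₂) + Λ) * (d j₁ + d j₂) / K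
        < ∑ i, F v (ω i x) - n * ((∑ b, F v b) / Fintype.card (TensorIdx d))}
      ⊆ (⋃ v ∈ V, EL v) ∪ EC := by
    rintro x ⟨v, hv, hx⟩
    by_contra hcon
    simp only [Set.mem_union, Set.mem_iUnion, not_or, not_exists] at hcon
    refine absurd hx (not_lt.2 (deviation_le hd h12 hτ (hX v hv) (hY v hv) (hX2 v hv) (hY2 v hv)
      (hF v hv) hΛ hK (fun i => ω i x) (not_le.1 (hcon.1 v hv)).le ?_))
    intro A B
    rcases A.eq_empty_or_nonempty with rfl | hA
    · simp; positivity
    rcases B.eq_empty_or_nonempty with rfl | hB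
    · simp; positivity
    have hA1 : (1 : ℝ) ≤ A.card := by exact_mod_cast hA.card_pos
    have hB1 : (1 : ℝ) ≤ B.card := by exact_mod_cast hB.card_pos
    have h1 : ¬ _ := fun h => hcon.2 ⟨A, B, h⟩
    refine (not_le.1 h1).le.trans ?_
    nlinarith
  calc _ ≤ μ.real ((⋃ v ∈ V, EL v) ∪ EC) := measureReal_mono hsub
    _ ≤ μ.real (⋃ v ∈ V, EL v) + μ.real EC := measureReal_union_le _ _
    _ ≤ (∑ v ∈ V, μ.real (EL v)) + μ.real EC := by
        gcongr
        exact measureReal_biUnion_finset_le _ _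
    _ ≤ (∑ _v ∈ V, Real.exp (-s)) + Real.exp (2 - s₀) := by
        gcongr with v hv
        · refine measureReal_sum_uniform_ge_le hindep hunif hτ (fun b => ?_) s
          unfold lightPart
          split_ifs with h
          · exact (hF v hv b).trans h
          · simpa using hτ.le
        · exact measureReal_count_ge_le hd hindep hunif h12 s₀
    _ = _ := by rw [Finset.sum_const, nsmul_eq_mul]

/-! ### Choice of the cut-offs -/

/-- The choice of the cut-offs `τ` (light versus heavy) and `K` (balanced versus unbalanced). Here
`D` is the sum of the dimensions, `LN` the logarithm of their product and `ℓ` that of their mean. The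
factor `2 ^ k` absorbs the `k + 1` lost in `1 ≤ (k + 1) ℓ` and `LN ≤ k ℓ`. -/
theorem exists_parameters_bound {k : ℕ} (hk : 2 ≤ k) {D ℓ LN lam α r P : ℝ} (hα : 0 < α)
    (hℓ : 1 / ((k : ℝ) + 1) ≤ ℓ) (hℓlam : ℓ ≤ lam) (hLN : 1 / 2 ≤ LN) (hℓLN : ℓ ≤ LN)
    (hLNk : LN ≤ k * ℓ) (hℓD : ℓ ≤ D) (hD : 2 ≤ D) (hr : r ≤ lam)
    (hP0 : 0 ≤ P) (hP : P ≤ D) :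
    ∃ τ K : ℝ, 0 < τ ∧ 0 < K ∧
      544 * r / τ + τ * (4 * D + α * ℓ + 1) + 128 * (LN + (α * ℓ + 3)) * K
        + 8 * (r + (LN + (α * ℓ + 3))) * P / K
      ≤ 80 * (3 * α + 7) * 2 ^ k * √(D * LN * lam) := by
  have hk1 : (0 : ℝ) < (k : ℝ) + 1 := by positivity
  have hℓ0 : 0 < ℓ := lt_of_lt_of_le (by positivity) hℓ
  have hlam : 0 < lam := hℓ0.trans_le hℓlam
  have hkℓ : 1 ≤ ((k : ℝ) + 1) * lam := by
    rw [div_le_iff₀ hk1] at hℓ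
    nlinarith
  have hpos : 0 < D * LN * lam := by positivity
  set R := √(D * LN * lam) with hR
  have hR0 : 0 < R := Real.sqrt_pos.2 hpos
  have hRR : R * R = D * LN * lam := Real.mul_self_sqrt hpos.le
  refine ⟨lam / R, R / LN, by positivity, by positivity, ?_⟩
  have h1 : 544 * r / (lam / R) ≤ 544 * R := by
    rw [div_le_iff₀ (by positivity)]
    have : 544 * R * (lam / R) = 544 * lam := by field_simp
    linarith
  have h2 : lam / R * (4 * D + α * ℓ + 1) ≤ 2 * (5 + α) * R := by
    rw [div_mul_eq_mul_div, div_le_iff₀ hR0]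
    have h3 : 4 * D + α * ℓ + 1 ≤ (5 + α) * (2 * (D * LN)) := by
      have : α * ℓ ≤ α * D := by gcongr
      have h5 : D ≤ 2 * (D * LN) := by nlinarith
      have : (5 + α) * D ≤ (5 + α) * (2 * (D * LN)) := by gcongr
      nlinarith
    calc lam * (4 * D + α * ℓ + 1) ≤ lam * ((5 + α) * (2 * (D * LN))) := by gcongr
      _ = 2 * (5 + α) * (R * R) := by rw [hRR]; ring
      _ = _ := by ring
  have h3 : 128 * (LN + (α * ℓ + 3)) * (R / LN) ≤ 128 * (7 + α) * R := by
    have : LN + (α * ℓ + 3) ≤ (7 + α) * LN := by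
      have : α * ℓ ≤ α * LN := by gcongr
      nlinarith
    calc 128 * (LN + (α * ℓ + 3)) * (R / LN) ≤ 128 * ((7 + α) * LN) * (R / LN) := by gcongr
      _ = _ := by field_simp
  have h4 : 8 * (r + (LN + (α * ℓ + 3))) * P / (R / LN) ≤ 8 * ((k + 1) * (4 + α)) * R := by
    rw [div_le_iff₀ (by positivity)]
    have h5 : r + (LN + (α * ℓ + 3)) ≤ (k + 1) * (4 + α) * lam := by
      have e1 : α * ℓ ≤ α * lam := by gcongr
      have e2 : LN ≤ k * lam := hLNk.trans (by gcongr)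
      have e3 : α * lam ≤ (k + 1) * (α * lam) :=
        le_mul_of_one_le_left (by positivity) (by linarith [Nat.cast_nonneg (α := ℝ) k])
      nlinarith
    calc 8 * (r + (LN + (α * ℓ + 3))) * P ≤ 8 * ((k + 1) * (4 + α) * lam) * D := by gcongr
      _ = 8 * ((k + 1) * (4 + α)) * ((D * LN * lam) / LN) := by field_simp
      _ = 8 * ((k + 1) * (4 + α)) * R * (R / LN) := by rw [← hRR]; ring
  have h2k : (k : ℝ) + 1 ≤ 2 ^ k := by exact_mod_cast (Nat.lt_two_pow_self (n := k))
  have h4k : (4 : ℝ) ≤ 2 ^ k := by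
    calc (4 : ℝ) = 2 ^ 2 := by norm_num
      _ ≤ 2 ^ k := pow_le_pow_right₀ (by norm_num) hk
  have h5 : 544 + 2 * (5 + α) + 128 * (7 + α) + 8 * (((k : ℝ) + 1) * (4 + α))
      ≤ 80 * (3 * α + 7) * 2 ^ k := by nlinarith
  calc _ ≤ (544 + 2 * (5 + α) + 128 * (7 + α) + 8 * (((k : ℝ) + 1) * (4 + α))) * R := by
        linarith
    _ ≤ _ := by gcongr

/-! ### Incoherent rank-one tensors -/

namespace Tensor

variable {k : ℕ} {d : Fin k → ℕ}

theorem abs_le_maxNorm (A : Tensor d) (a : TensorIdx d) : |A a| ≤ A.maxNorm :=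
  le_ciSup (f := fun a => |A a|) (Set.finite_range _).bddAbove a

theorem maxNorm_pos {A : Tensor d} (hA : A ≠ 0) : 0 < A.maxNorm := by
  obtain ⟨a, ha⟩ := Function.ne_iff.1 hA
  exact (abs_pos.2 ha).trans_le (abs_le_maxNorm A a)

theorem dot_sampleMean_sub {n : ℕ} (hn : 1 ≤ n) (hd : ∀ j, 1 ≤ d j) (A Y : Tensor d)
    (w : Fin n → TensorIdx d) :
    dot Y (sampleMean A w - A) = (∏ j, (d j : ℝ)) / n *
      (∑ i, Y (w i) * A (w i)
        - n * ((∑ a, Y a * A a) / Fintype.card (TensorIdx d))) := by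
  have hn0 : (n : ℝ) ≠ 0 := by positivity
  have hcard : (Fintype.card (TensorIdx d) : ℝ) = ∏ j, (d j : ℝ) := by simp [Fintype.card_pi]
  have hN0 : (∏ j, (d j : ℝ)) ≠ 0 :=
    Finset.prod_ne_zero_iff.2 fun j _ => by have := hd j; positivity
  have h1 : ∀ i, ∑ a, Y a * sample A (w i) a = (∏ j, (d j : ℝ)) * (Y (w i) * A (w i)) := by
    intro i
    rw [Finset.sum_eq_single (w i)]
    · simp [sample, proj]; ring
    · intro b _ hb
      simp [sample, proj, hb]
    · simp
  have h2 : ∑ a, Y a * sampleMean A w a = (1 / n : ℝ) * ∑ i, ∑ a, Y a * sample A (w i) a := by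
    rw [Finset.sum_comm, Finset.mul_sum]
    refine Finset.sum_congr rfl fun a _ => ?_
    simp only [sampleMean, Pi.smul_apply, Finset.sum_apply, smul_eq_mul, ← Finset.mul_sum]
    ring
  have h3 : dot Y (sampleMean A w - A)
      = ∑ a, Y a * sampleMean A w a - ∑ a, Y a * A a := by
    rw [dot, ← Finset.sum_sub_distrib]
    exact Finset.sum_congr rfl fun a _ => by rw [Pi.sub_apply, mul_sub]
  rw [h3, h2, hcard]
  simp only [h1, ← Finset.mul_sum]
  field_simp

/-- The product of the `δ_j` over `j ≠ j₁, j₂`. -/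
noncomputable def offPairProd (δ : Fin k → ℝ) (j₁ j₂ : Fin k) : ℝ := ∏ j with ¬ (j = j₁ ∨ j = j₂), δ j

theorem prod_eq_mul_offPair (f : Fin k → ℝ) {j₁ j₂ : Fin k} (h12 : j₁ ≠ j₂) :
    ∏ j, f j = f j₁ * f j₂ * ∏ j with ¬ (j = j₁ ∨ j = j₂), f j := by
  rw [← Finset.prod_filter_mul_prod_filter_not Finset.univ (fun j => j = j₁ ∨ j = j₂)]
  congr 1
  have : (Finset.univ.filter fun j => j = j₁ ∨ j = j₂) = {j₁, j₂} := by ext; simp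
  rw [this, Finset.prod_pair h12]

/-- The finite sets whose convex hulls contain the admissible vectors of each mode: grid points for
the two free modes, and the vertices of the cube of radius `δ_j` for the incoherent ones, where the
`ℓ₂` constraint is dropped. -/
noncomputable def pairNet (d : Fin k → ℕ) (δ : Fin k → ℝ) (j₁ j₂ : Fin k) (j : Fin k) :
    Finset (Fin (d j) → ℝ) :=
  if j = j₁ ∨ j = j₂ then gridNet (d j) else signNet (d j) (δ j)

theorem card_piFinset_pairNet_le (δ : Fin k → ℝ) (j₁ j₂ : Fin k) :
    ((Fintype.piFinset (pairNet d δ j₁ j₂)).card : ℝ) ≤ Real.exp (4 * ∑ j, (d j : ℝ)) := by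
  rw [Fintype.card_piFinset, Finset.mul_sum, Real.exp_sum]
  push_cast
  refine Finset.prod_le_prod (fun j _ => Nat.cast_nonneg _) fun j _ => ?_
  unfold pairNet
  split_ifs
  · exact card_gridNet_le _
  · exact card_signNet_le _ _

theorem exists_pairNet_dot_le {δ : Fin k → ℝ} {j₁ j₂ : Fin k} {Y : Tensor d}
    (hY : Y ∈ incoherentPair δ j₁ j₂) (X : Tensor d) :
    ∃ v ∈ Fintype.piFinset (pairNet d δ j₁ j₂), dot Y X ≤ dot (fun a => ∏ j, v j (a j)) X := by
  obtain ⟨u, rfl, hu1, hu2⟩ := hY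
  refine exists_rankOne_le X (pairNet d δ j₁ j₂) (fun j i => u j i) fun j => ?_
  unfold pairNet
  split_ifs with h
  · refine mem_convexHull_gridNet ?_
    have := hu1 j
    rw [← sq_le_one_iff₀ (norm_nonneg _), EuclideanSpace.norm_sq_eq] at this
    simpa [sq_abs] using this
  · rw [not_or] at h
    exact mem_convexHull_signNet (hu2 j h.1 h.2)

/-- The tail bound for the supremum over one class of incoherent rank-one tensors. Here `ℓ` and `LN`
stand for the logarithms of the mean and of the product of the dimensions. -/
theorem measureReal_incoherentPair_le {n : ℕ} (hk : 2 ≤ k) (hn : 1 ≤ n)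
    (hd : ∀ j, 1 ≤ d j) {δ : Fin k → ℝ} (hδ : ∀ j, 0 < δ j) {A : Tensor d} (hA : A ≠ 0)
    {Ω : Type*} [MeasurableSpace Ω] {μ : Measure Ω} [IsProbabilityMeasure μ]
    {ω : Fin n → Ω → TensorIdx d} (hindep : iIndepFun ω μ)
    (hunif : ∀ i, HasLaw (ω i) (uniformOn (Set.univ : Set (TensorIdx d))) μ)
    {j₁ j₂ : Fin k} (h12 : j₁ ≠ j₂) {α ℓ LN : ℝ} (hα : 0 < α)
    (hℓ : 1 / ((k : ℝ) + 1) ≤ ℓ) (hLN : 1 / 2 ≤ LN) (hℓLN : ℓ ≤ LN) (hLNk : LN ≤ k * ℓ)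
    (hℓD : ℓ ≤ ∑ j, (d j : ℝ)) (hlog : ∀ j, Real.log (d j) ≤ LN) :
    μ.real {x | ∃ Y ∈ incoherentPair δ j₁ j₂,
        80 * (3 * α + 7) * 2 ^ k * √((∑ j, (d j : ℝ)) * LN * (n / (d j₁ * d j₂) + ℓ))
          * ((∏ j, (d j : ℝ)) / n * (A.maxNorm * offPairProd δ j₁ j₂))
        < dot Y (sampleMean A (fun i => ω i x) - A)}
      ≤ Real.exp (-(α * ℓ)) := by
  set D : ℝ := ∑ j, (d j : ℝ) with hDdef
  have hℓ0 : 0 < ℓ := lt_of_lt_of_le (by positivity) hℓ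
  have hk0 : (0 : ℝ) ≤ k := Nat.cast_nonneg k
  have hsub : (∑ j ∈ ({j₁, j₂} : Finset (Fin k)), (d j : ℝ)) ≤ D :=
    Finset.sum_le_sum_of_subset_of_nonneg (Finset.subset_univ _) fun j _ _ => Nat.cast_nonneg _
  rw [Finset.sum_pair h12] at hsub
  have hp : (1 : ℝ) ≤ d j₁ := by exact_mod_cast hd j₁
  have hq : (1 : ℝ) ≤ d j₂ := by exact_mod_cast hd j₂
  set r : ℝ := n / (d j₁ * d j₂) with hr
  have hr0 : 0 ≤ r := by positivity
  obtain ⟨τ, K, hτ, hK, hbound⟩ := exists_parameters_bound hk (D := D) (ℓ := ℓ) (LN := LN)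
    (lam := r + ℓ) (r := r) (P := (d j₁ : ℝ) + d j₂) hα hℓ (by linarith) hLN hℓLN hLNk hℓD
    (by linarith) (by linarith) (by linarith) hsub
  set R := 80 * (3 * α + 7) * 2 ^ k * √(D * LN * (r + ℓ)) with hR
  have hM := maxNorm_pos hA
  have hΔ : 0 < offPairProd δ j₁ j₂ := Finset.prod_pos fun j _ => hδ j
  set c := A.maxNorm * offPairProd δ j₁ j₂ with hc
  have hc0 : 0 < c := mul_pos hM hΔ
  have hN0 : 0 < (∏ j, (d j : ℝ)) / n := by
    have : 0 < ∏ j, (d j : ℝ) := Finset.prod_pos fun j _ => by have := hd j; positivity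
    positivity
  let V := Fintype.piFinset (pairNet d δ j₁ j₂)
  -- After division by `c` the summands are dominated by `|v j₁| |v j₂|`.
  let F : (∀ j, Fin (d j) → ℝ) → TensorIdx d → ℝ := fun v w => (∏ j, v j (w j)) * A w / c
  have hgrid : ∀ v ∈ V, ∀ j, j = j₁ ∨ j = j₂ → ∑ a, |v j a| ^ 2 ≤ 4 := by
    intro v hv j hj
    simp only [sq_abs]
    refine sum_sq_le_of_mem_gridNet ?_
    have := Fintype.mem_piFinset.1 hv j
    rwa [pairNet, if_pos hj] at this
  have hF : ∀ v ∈ V, ∀ w, |F v w| ≤ |v j₁ (w j₁)| * |v j₂ (w j₂)| := by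
    intro v hv w
    have hoff : ∏ j with ¬ (j = j₁ ∨ j = j₂), |v j (w j)| ≤ offPairProd δ j₁ j₂ := by
      refine Finset.prod_le_prod (fun j _ => abs_nonneg _) fun j hj => ?_
      have h1 := (Finset.mem_filter.1 hj).2
      have := Fintype.mem_piFinset.1 hv j
      rw [pairNet, if_neg h1] at this
      exact abs_le_of_mem_signNet (hδ j).le this _
    simp only [F]
    rw [abs_div, abs_of_pos hc0, div_le_iff₀ hc0, abs_mul, Finset.abs_prod,
      prod_eq_mul_offPair _ h12]
    calc _ ≤ |v j₁ (w j₁)| * |v j₂ (w j₂)| * offPairProd δ j₁ j₂ * A.maxNorm := by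
          gcongr
          exact abs_le_maxNorm A w
      _ = _ := by rw [hc]; ring
  have h := measureReal_deviation_gt_le hd hindep hunif h12 V (fun v a => |v j₁ a|)
    (fun v b => |v j₂ b|) F (fun _ _ _ => abs_nonneg _) (fun _ _ _ => abs_nonneg _)
    (fun v hv => hgrid v hv j₁ (Or.inl rfl)) (fun v hv => hgrid v hv j₂ (Or.inr rfl)) hF
    (s := 4 * D + α * ℓ + 1) (s₀ := α * ℓ + 3) (Λ := LN + (α * ℓ + 3)) hτ hK (by positivity)
    (by linarith [hlog j₁]) (by linarith [hlog j₂])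
  calc _ ≤ _ := measureReal_mono ?_
    _ ≤ _ := h
    _ ≤ Real.exp (4 * D) * Real.exp (-(4 * D + α * ℓ + 1)) + Real.exp (2 - (α * ℓ + 3)) := by
        gcongr
        exact card_piFinset_pairNet_le δ j₁ j₂
    _ = Real.exp (-(α * ℓ)) * (2 * Real.exp (-1)) := by
        rw [← Real.exp_add, show 4 * D + -(4 * D + α * ℓ + 1) = -(α * ℓ) + -1 by ring,
          show 2 - (α * ℓ + 3) = -(α * ℓ) + -1 by ring, Real.exp_add]
        ring
    _ ≤ Real.exp (-(α * ℓ)) * 1 := by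
        gcongr
        rw [Real.exp_neg, ← div_eq_mul_inv, div_le_one (Real.exp_pos _)]
        linarith [Real.add_one_le_exp (1 : ℝ)]
    _ = _ := mul_one _
  rintro x ⟨Y, hY, hx⟩
  obtain ⟨v, hv, hvle⟩ := exists_pairNet_dot_le hY (sampleMean A (fun i => ω i x) - A)
  refine ⟨v, hv, lt_of_le_of_lt hbound ?_⟩
  have h1 := hx.trans_le hvle
  rw [dot_sampleMean_sub hn hd] at h1
  have h2 : ∑ i, F v (ω i x) - n * ((∑ b, F v b) / Fintype.card (TensorIdx d))
      = (∑ i, (∏ j, v j (ω i x j)) * A (ω i x)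
        - n * ((∑ a : TensorIdx d, (∏ j, v j (a j)) * A a) / Fintype.card (TensorIdx d))) / c := by
    simp only [F]
    rw [← Finset.sum_div, ← Finset.sum_div]
    ring
  rw [h2, lt_div_iff₀ hc0]
  refine lt_of_mul_lt_mul_left (lt_of_eq_of_lt ?_ h1) hN0.le
  ring

end Tensor

/-! ### The number of pairs of modes -/

theorem card_modePair_le (k : ℕ) : (Fintype.card (ModePair k) : ℝ) ≤ 1 / 2 * (k : ℝ) ^ 2 := by
  have hinj : Function.Injective (fun z : ModePair k × Bool =>
      if z.2 then z.1.1 else z.1.1.swap) := by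
    rintro ⟨⟨⟨a, b⟩, hab⟩, s⟩ ⟨⟨⟨a', b'⟩, hab'⟩, s'⟩ h
    cases s <;> cases s' <;> simp at h hab hab' ⊢ <;> grind
  have h := Fintype.card_le_of_injective _ hinj
  simp only [Fintype.card_prod, Fintype.card_bool, Fintype.card_fin] at h
  have h' : (Fintype.card (ModePair k) : ℝ) * 2 ≤ k * k := by exact_mod_cast h
  nlinarith

/-! ### Means of the dimensions -/

section dimensions
variable {k : ℕ} {d : Fin k → ℕ}

theorem arithMean_mul_card (hk : k ≠ 0) (x : Fin k → ℝ) : k * arithMean x = ∑ j, x j := by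
  have : (k : ℝ) ≠ 0 := by exact_mod_cast hk
  rw [arithMean]; field_simp

theorem geomMean_pow (hk : k ≠ 0) {x : Fin k → ℝ} (hx : ∀ j, 0 ≤ x j) :
    geomMean x ^ k = ∏ j, x j := by
  rw [geomMean, one_div, Real.rpow_inv_natCast_pow (Finset.prod_nonneg fun j _ => hx j) hk]

theorem log_geomMean_mul_card (hk : k ≠ 0) {x : Fin k → ℝ} (hx : ∀ j, 0 < x j) :
    k * Real.log (geomMean x) = Real.log (∏ j, x j) := by
  rw [← geomMean_pow hk fun j => (hx j).le, Real.log_pow]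

/-- The inequality of arithmetic and geometric means, in logarithmic form. -/
theorem log_prod_le_mul_log_arithMean (hk : k ≠ 0) {x : Fin k → ℝ} (hx : ∀ j, 0 < x j) :
    Real.log (∏ j, x j) ≤ k * Real.log (arithMean x) := by
  have hk0 : (0 : ℝ) < k := by exact_mod_cast Nat.pos_of_ne_zero hk
  have : Nonempty (Fin k) := ⟨⟨0, Nat.pos_of_ne_zero hk⟩⟩
  have hsum := arithMean_mul_card hk x
  have hm : 0 < arithMean x := by
    have : 0 < ∑ j, x j := Finset.sum_pos (fun j _ => hx j) Finset.univ_nonempty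
    rw [← hsum] at this
    exact pos_of_mul_pos_right this hk0.le
  rw [Real.log_prod fun j _ => (hx j).ne']
  calc ∑ j, Real.log (x j) ≤ ∑ j, (Real.log (arithMean x) + (x j / arithMean x - 1)) := by
        refine Finset.sum_le_sum fun j _ => ?_
        have h1 := Real.log_le_sub_one_of_pos (div_pos (hx j) hm)
        rw [Real.log_div (hx j).ne' hm.ne'] at h1
        linarith
    _ = k * Real.log (arithMean x) := by
        rw [Finset.sum_add_distrib, Finset.sum_sub_distrib, ← Finset.sum_div, ← hsum]
        simp
        field_simp
        ring

theorem natCast_le_prod (hd : ∀ j, 1 ≤ d j) (j : Fin k) : (d j : ℝ) ≤ ∏ i, (d i : ℝ) := by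
  have : d j ≤ ∏ i, d i :=
    Nat.le_of_dvd (Finset.prod_pos fun i _ => hd i) (Finset.dvd_prod_of_mem d (Finset.mem_univ j))
  exact_mod_cast this

theorem arithMean_le_prod (hk : k ≠ 0) (hd : ∀ j, 1 ≤ d j) :
    (arithMean fun j => (d j : ℝ)) ≤ ∏ i, (d i : ℝ) := by
  have hk0 : (0 : ℝ) < k := by exact_mod_cast Nat.pos_of_ne_zero hk
  refine le_of_mul_le_mul_left ?_ hk0
  rw [arithMean_mul_card hk]
  calc ∑ j, (d j : ℝ) ≤ ∑ _j : Fin k, ∏ i, (d i : ℝ) :=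
        Finset.sum_le_sum fun j _ => natCast_le_prod hd j
    _ = _ := by simp

theorem card_add_one_le_sum (hd : ∀ j, 1 ≤ d j) {j : Fin k} (hj : d j ≠ 1) :
    (k : ℝ) + 1 ≤ ∑ i, (d i : ℝ) := by
  have h : ∑ _i : Fin k, 1 < ∑ i, d i :=
    Finset.sum_lt_sum (fun i _ => hd i) ⟨j, Finset.mem_univ j, lt_of_le_of_ne (hd j) (Ne.symm hj)⟩
  simp at h
  exact_mod_cast h

theorem one_div_le_log_arithMean (hk : k ≠ 0) (hd : ∀ j, 1 ≤ d j) {j : Fin k} (hj : d j ≠ 1) :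
    1 / ((k : ℝ) + 1) ≤ Real.log (arithMean fun j => (d j : ℝ)) := by
  have hk0 : (0 : ℝ) < k := by exact_mod_cast Nat.pos_of_ne_zero hk
  have h1 := card_add_one_le_sum hd hj
  rw [← arithMean_mul_card hk] at h1
  set m := arithMean fun j => (d j : ℝ)
  have hm : ((k : ℝ) + 1) / k ≤ m := by rw [div_le_iff₀ hk0]; linarith
  calc 1 / ((k : ℝ) + 1) = 1 - (((k : ℝ) + 1) / k)⁻¹ := by field_simp; ring
    _ ≤ Real.log (((k : ℝ) + 1) / k) := Real.one_sub_inv_le_log_of_pos (by positivity)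
    _ ≤ Real.log m := Real.log_le_log (by positivity) hm

end dimensions

/-! ### The incoherent norm -/

theorem theorem2
    {k n : ℕ} (hk : 2 ≤ k) (hn : 1 ≤ n)
    (d : Fin k → ℕ) (hd : ∀ j, 1 ≤ d j)
    (δ : Fin k → ℝ) (hδ : ∀ j, 0 < δ j ∧ δ j ≤ 1)
    (A : Tensor d) (hA : A ≠ 0)
    {Ω : Type*} [MeasurableSpace Ω] (μ : Measure Ω) [IsProbabilityMeasure μ]
    (ω : Fin n → Ω → TensorIdx d)
    (hindep : iIndepFun ω μ)
    (hunif : ∀ i, HasLaw (ω i) (uniformOn (Set.univ : Set (TensorIdx d))) μ)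
    (dbar dstar δstar δstar2 : ℝ)
    (hdbar : dbar = arithMean fun j => (d j : ℝ))
    (hdstar : dstar = geomMean fun j => (d j : ℝ))
    (hδstar : δstar = geomMean δ)
    (hδstar2 : δstar2 = minPairGeom δ)
    (hlarge : 8 * Real.exp 1 / (9 * Real.log 2) * (k : ℝ) ^ 2 * Real.log dbar ^ 3 ≤ dbar)
    (α : ℝ) (hα : 0 < α) (t : ℝ)
    (ht : 160 * (3 * α + 7) * ((k : ℝ) / n) * Real.sqrt (dbar * Real.log dstar)
        * (2 * δstar * dstar) ^ k * A.maxNorm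
        * Real.sqrt (⨆ p : ModePair k,
            ((n : ℝ) / (δ p.1.1 ^ 2 * d p.1.1 * (δ p.1.2 ^ 2 * d p.1.2))
              + Real.log dbar / (δ p.1.1 ^ 2 * δ p.1.2 ^ 2))) ≤ t) :
    μ.real {x | t ≤ Tensor.incoherentNorm δ (Tensor.sampleMean A (fun i => ω i x) - A)}
      ≤ 1 / 2 * (k : ℝ) ^ 2 * dbar ^ (-α)
        + 1 / (4 * Real.log 2 ^ 2) * (k : ℝ) ^ 2 * Real.log dbar ^ 2
          * (Real.exp (-(9 * n * t ^ 2
                / (64 * k * dstar ^ k * A.maxNorm ^ 2 * Real.log dstar)))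
            + Real.exp (-(9 * n * t
                / (32 * k * δstar ^ k * δstar2 ^ (-2 : ℤ) * dstar ^ k * A.maxNorm
                    * Real.log dstar)))) := by
  have hk0 : k ≠ 0 := by omega
  have hkpos : (0 : ℝ) < k := by positivity
  have hdpos : ∀ j, (0 : ℝ) < d j := fun j => by have := hd j; positivity
  by_cases hall : ∀ j, d j = 1
  · -- A single position: `dbar = 1`, and the right-hand side is at least `k² / 2 ≥ 1`.
    have h1 : dbar = 1 := by
      rw [hdbar]; simp [arithMean, hall, hk0]
    have hk2 : (2 : ℝ) ≤ k := by exact_mod_cast hk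
    rw [h1, Real.one_rpow]
    refine measureReal_le_one.trans ?_
    refine le_add_of_le_of_nonneg (by nlinarith) (by positivity)
  push Not at hall
  obtain ⟨j₀, hj₀⟩ := hall
  set N : ℝ := ∏ j, (d j : ℝ) with hN
  set D : ℝ := ∑ j, (d j : ℝ) with hD
  have hN2 : 2 ≤ N := by
    have h2 : 2 ≤ d j₀ := by have := hd j₀; omega
    exact le_trans (by exact_mod_cast h2) (natCast_le_prod hd j₀)
  have hkd : k * dbar = D := by rw [hdbar]; exact arithMean_mul_card hk0 _
  have hℓ : 1 / ((k : ℝ) + 1) ≤ Real.log dbar := by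
    rw [hdbar]; exact one_div_le_log_arithMean hk0 hd hj₀
  have hℓ0 : 0 < Real.log dbar := lt_of_lt_of_le (by positivity) hℓ
  have hdbar0 : 0 < dbar := by
    have : 0 < D := by linarith [card_add_one_le_sum hd hj₀]
    rw [← hkd] at this
    exact pos_of_mul_pos_right this hkpos.le
  have hLN2 : 1 / 2 ≤ Real.log N := by
    have := Real.log_le_log two_pos hN2
    linarith [Real.log_two_gt_d9]
  have hℓLN : Real.log dbar ≤ Real.log N :=
    Real.log_le_log hdbar0 (by rw [hdbar]; exact arithMean_le_prod hk0 hd)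
  have hLNk : Real.log N ≤ k * Real.log dbar := by
    rw [hdbar]; exact log_prod_le_mul_log_arithMean hk0 hdpos
  have hℓD : Real.log dbar ≤ D := by
    have h1 := Real.log_le_sub_one_of_pos hdbar0
    have hk1 : (1 : ℝ) ≤ k := by exact_mod_cast (by omega : 1 ≤ k)
    nlinarith
  have hlog : ∀ j, Real.log (d j) ≤ Real.log N := fun j =>
    Real.log_le_log (hdpos j) (natCast_le_prod hd j)
  have hM := Tensor.maxNorm_pos hA
  have hlogstar : k * Real.log dstar = Real.log N := by
    rw [hdstar]; exact log_geomMean_mul_card hk0 hdpos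
  have hpow : (2 * δstar * dstar) ^ k = 2 ^ k * (∏ j, δ j) * N := by
    rw [mul_pow, mul_pow, hδstar, hdstar, geomMean_pow hk0 fun j => (hδ j).1.le,
      geomMean_pow hk0 fun j => (hdpos j).le]
  have hsqrt : (k : ℝ) * √(dbar * Real.log dstar) = √(D * Real.log N) := by
    rw [← hkd, ← hlogstar, show k * dbar * (k * Real.log dstar)
      = (k : ℝ) ^ 2 * (dbar * Real.log dstar) by ring, Real.sqrt_mul (sq_nonneg (k : ℝ)),
      Real.sqrt_sq hkpos.le]
  -- For each pair of modes, the threshold of the pair is at most `t / 2`.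
  let thr : ModePair k → ℝ := fun p =>
    80 * (3 * α + 7) * 2 ^ k
        * √(D * Real.log N * (n / (d p.1.1 * d p.1.2) + Real.log dbar))
      * (N / n * (A.maxNorm * Tensor.offPairProd δ p.1.1 p.1.2))
  have hthr0 : ∀ p, 0 < thr p := fun p => by
    have h1 : 0 < Tensor.offPairProd δ p.1.1 p.1.2 := Finset.prod_pos fun j _ => (hδ j).1
    have h2 := hdpos p.1.1
    have h3 := hdpos p.1.2
    have h4 : 0 < Real.log N := by linarith
    have h5 : 0 < D := by linarith
    have h6 : (0 : ℝ) < n := by positivity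
    positivity
  have hthr : ∀ p, thr p ≤ t / 2 := by
    intro p
    have hδ1 := (hδ p.1.1).1
    have hδ2 := (hδ p.1.2).1
    have hsup := le_ciSup (f := fun p : ModePair k =>
      ((n : ℝ) / (δ p.1.1 ^ 2 * d p.1.1 * (δ p.1.2 ^ 2 * d p.1.2))
        + Real.log dbar / (δ p.1.1 ^ 2 * δ p.1.2 ^ 2))) (Set.finite_range _).bddAbove p
    have hval : √((n : ℝ) / (δ p.1.1 ^ 2 * d p.1.1 * (δ p.1.2 ^ 2 * d p.1.2))
        + Real.log dbar / (δ p.1.1 ^ 2 * δ p.1.2 ^ 2))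
        = √(n / (d p.1.1 * d p.1.2) + Real.log dbar) / (δ p.1.1 * δ p.1.2) := by
      rw [show (n : ℝ) / (δ p.1.1 ^ 2 * d p.1.1 * (δ p.1.2 ^ 2 * d p.1.2))
        + Real.log dbar / (δ p.1.1 ^ 2 * δ p.1.2 ^ 2)
        = (n / (d p.1.1 * d p.1.2) + Real.log dbar) / (δ p.1.1 * δ p.1.2) ^ 2 by
          have := (hdpos p.1.1).ne'
          have := (hdpos p.1.2).ne'
          field_simp]
      rw [Real.sqrt_div' _ (by positivity), Real.sqrt_sq (by positivity)]
    have hprod := Tensor.prod_eq_mul_offPair δ p.2.ne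
    have hDN : 0 ≤ D * Real.log N := mul_nonneg (by linarith) (by linarith)
    have hδprod : 0 ≤ ∏ j, δ j := Finset.prod_nonneg fun j _ => (hδ j).1.le
    calc thr p = (160 * (3 * α + 7) * ((k : ℝ) / n) * √(dbar * Real.log dstar)
        * (2 * δstar * dstar) ^ k * A.maxNorm
        * √((n : ℝ) / (δ p.1.1 ^ 2 * d p.1.1 * (δ p.1.2 ^ 2 * d p.1.2))
              + Real.log dbar / (δ p.1.1 ^ 2 * δ p.1.2 ^ 2))) / 2 := by
          simp only [thr]
          rw [hval, hpow, Real.sqrt_mul hDN, ← hsqrt, hprod]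
          unfold Tensor.offPairProd
          field_simp
          ring
      _ ≤ t / 2 := by
          refine div_le_div_of_nonneg_right (le_trans ?_ ht) zero_le_two
          rw [hpow]
          gcongr
  let E : ModePair k → Set Ω := fun p => {x | ∃ Y ∈ Tensor.incoherentPair δ p.1.1 p.1.2,
    thr p < Tensor.dot Y (Tensor.sampleMean A (fun i => ω i x) - A)}
  have hE : ∀ p, μ.real (E p) ≤ dbar ^ (-α) := by
    intro p
    have := Tensor.measureReal_incoherentPair_le hk hn hd (fun j => (hδ j).1) hA hindep hunif
      p.2.ne hα hℓ hLN2 hℓLN hLNk hℓD hlog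
    refine this.trans (le_of_eq ?_)
    rw [Real.rpow_def_of_pos hdbar0]; congr 1; ring
  have hsub : {x | t ≤ Tensor.incoherentNorm δ (Tensor.sampleMean A (fun i => ω i x) - A)}
      ⊆ ⋃ p, E p := by
    intro x hx
    by_contra hcon
    simp only [Set.mem_iUnion, not_exists] at hcon
    let p₀ : ModePair k := ⟨(⟨0, by omega⟩, ⟨1, by omega⟩), by simp⟩
    have ht0 : 0 < t := by linarith [hthr0 p₀, hthr p₀]
    have hle : Tensor.incoherentNorm δ (Tensor.sampleMean A (fun i => ω i x) - A) ≤ t / 2 := by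
      refine csSup_le ?_ ?_
      · refine Set.Nonempty.image _ ⟨Tensor.rankOne fun _ => 0, Set.mem_iUnion.2 ⟨p₀, ?_⟩⟩
        exact ⟨fun _ => 0, rfl, by simp, fun j _ _ i => by simpa using (hδ j).1.le⟩
      · rintro _ ⟨Y, hY, rfl⟩
        obtain ⟨p, hp⟩ := Set.mem_iUnion.1 hY
        exact (not_lt.1 fun h => hcon p ⟨Y, hp, h⟩).trans (hthr p)
    have hx' : t ≤ _ := hx
    linarith
  calc _ ≤ μ.real (⋃ p, E p) := measureReal_mono hsub
    _ ≤ ∑ p, μ.real (E p) := measureReal_iUnion_fintype_le _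
    _ ≤ ∑ _p : ModePair k, dbar ^ (-α) := Finset.sum_le_sum fun p _ => hE p
    _ = Fintype.card (ModePair k) * dbar ^ (-α) := by
        rw [Finset.sum_const, Finset.card_univ, nsmul_eq_mul]
    _ ≤ 1 / 2 * (k : ℝ) ^ 2 * dbar ^ (-α) := by
        have := Real.rpow_pos_of_pos hdbar0 (-α)
        gcongr
        exact card_modePair_le k
    _ ≤ _ := le_add_of_nonneg_right (by positivity)
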